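/- For $k\ge 1$ consider $k$ alternatives with independent normal observations $X_{ij}$ ($1\le i\le k$, $j\ge 1$), where $X_{ij}\sim N(\mu_i,\sigma_i^2)$, and write $\bar X_i(n)=\frac1n\sum_{j=1}^n X_{ij}$. The greedy procedure with total budget $B$ first takes one observation from every alternative; then, until $B$ observations have been taken in total, it takes each further observation from an alternative whose current sample mean is largest; finally it selects an alternative whose current sample mean is largest (ties are broken by an arbitrary rule). Let $\mathrm{PCS}$ be the probability that alternative $1$ is selected. For $x>0$ let $$C(x)=\exp\Big(\sum_{n=1}^\infty \frac1n\,\Phi(-\sqrt n\,x)\Big),$$ where $\Phi$ is the standard normal distribution function. Suppose that $\mu_1-\mu_i=\gamma>0$ for all $i=2,\dots,k$ and $\sigma_i^2=\sigma^2>0$ for all $i=1,\dots,k$, with $\gamma$ and $\sigma>0$ not depending on $k$. Let $c>C(\gamma/\sigma)$ and let the budget be $B=ck$ (rounded up or down to an integer if $ck$ is not an integer). Then there is exactly one $\gamma_0\in(0,\gamma)$ with $C\big((\gamma-\gamma_0)/\sigma\big)=c$, and $$\lim_{k\to\infty}\mathrm{PCS}=\Pr\Big\{\min_{n\ge1}\bar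 X_1(n)>\mu_1-\gamma_0\Big\}=\Big[C\Big(\frac{\gamma_0}{\sigma}\Big)\Big]^{-1}.$$ -/

import Mathlib

open MeasureTheory ProbabilityTheory Filter Topology

noncomputable section

/-- The distribution function `Φ` of the standard normal distribution. -/
def stdNormalCDF (x : ℝ) : ℝ := cdf (gaussianReal 0 1) x

/-- `C(x) = exp (∑_{n ≥ 1} (1/n) Φ(-√n x))`; the series converges for every `x > 0`. -/
def boundaryC (x : ℝ) : ℝ :=
  Real.exp (∑' n : ℕ, (1 / ((n : ℝ) + 1)) * stdNormalCDF (-(√((n : ℝ) + 1) * x)))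

/-- The average of the first `n` terms of the sequence of observations `x 0, x 1, …`. -/
def runningAvg (x : ℕ → ℝ) (n : ℕ) : ℝ := (∑ j ∈ Finset.range n, x j) / n

/-- `a` returns an index at which the vector is largest; ties may be broken in any way. -/
def IsArgmaxRule {ι : Type*} (a : (ι → ℝ) → ι) : Prop := ∀ (v : ι → ℝ) (i : ι), v i ≤ v (a v)

/-- Sample sizes of the greedy procedure: `greedyCounts a x t i` is the number of observations
taken from alternative `i` after one initial observation of every alternative and `t` further
ones, each of which goes to the alternative with the largest current sample mean.
The `(j+1)`-st observation of alternative `i` is `x i j`. -/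
def greedyCounts {ι : Type*} [DecidableEq ι] (a : (ι → ℝ) → ι) (x : ι → ℕ → ℝ) :
    ℕ → ι → ℕ
  | 0 => fun _ => 1
  | t + 1 =>
    let n := greedyCounts a x t
    let s := a (fun i => runningAvg (x i) (n i))
    Function.update n s (n s + 1)

/-- The alternative selected by the greedy procedure with a total of `B` observations: the one
with the largest sample mean when the budget is exhausted. -/
def greedySelection {ι : Type*} [Fintype ι] [DecidableEq ι] (a : (ι → ℝ) → ι)
    (x : ι → ℕ → ℝ) (B : ℕ) : ι :=
  a (fun i => runningAvg (x i) (greedyCounts a x (B - Fintype.card ι) i))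

/-- The probability that the greedy procedure selects the alternative `best`. -/
def greedyPCS {Ω ι : Type*} [MeasurableSpace Ω] [Fintype ι] [DecidableEq ι] (P : Measure Ω)
    (X : ι → ℕ → Ω → ℝ) (a : (ι → ℝ) → ι) (B : ℕ) (best : ι) : ℝ :=
  P.real {ω | greedySelection a (fun i j => X i j ω) B = best}

/-- The probability that the running averages over `n ≥ 1` observations have a minimum and that
this minimum exceeds `b`. -/
def probMinAbove {Ω : Type*} [MeasurableSpace Ω] (P : Measure Ω) (X : ℕ → Ω → ℝ) (b : ℝ) : ℝ :=
  P.real {ω | ∃ m : ℝ,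
    IsLeast {y : ℝ | ∃ n : ℕ, 1 ≤ n ∧ y = runningAvg (fun j => X j ω) n} m ∧ b < m}

end

/-! Standardize the observations and measure levels in units of `σ` above the common inferior mean.
As long as some alternative has a running average above a level x, the greedy rule observes no
alternative beyond its first passage to x (`greedyCounts_le`). For inferior alternatives these
passage times are i.i.d. with mean C(x) (`lintegral_passageTime`), so by the law of large numbers
bringing all of them down to x costs about k C(x) observations. The critical level is therefore the
x with C(x) = c, that is x = (γ - γ₀)/σ, or μ₁ - γ₀ in the original units.

If the averages of the best alternative stay above the critical level, then, their minimum being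
attained, they also stay above a slightly higher level, which the others reach with budget to spare.
The surplus carries the best alternative past its last minimum, after which it alone is observed
(`greedySelection_eq`). If its averages drop below the critical level, the others reach a level just
above x cheaply enough that the best alternative is driven to its passage below x, but they cannot
all reach a level just below x; the best alternative is stuck there and is not selected
(`greedySelection_ne`). So PCS tends to the probability that its averages stay above μ₁ - γ₀.

Both appearances of C come from fluctuation theory. Splitting a random walk at the time of its first
maximum gives the Sparre Andersen recursion `succ_mul_stayPos_succ`, whose generating function is an
exponential. For drift -x the probabilities of staying positive sum to C(x), the mean passage time
(`hasSum_stayPos`); for drift x they decrease to 1/C(x) (`normalSeqLaw_real_iInter_stayPos`). -/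

/-- `n` is the first positive index at which the running average of `z` is at most `x`. -/
def IsFirstPassage (x : ℝ) (z : ℕ → ℝ) (n : ℕ) : Prop :=
  1 ≤ n ∧ runningAvg z n ≤ x ∧ ∀ m, 1 ≤ m → m < n → x < runningAvg z m

/-! ### Deterministic analysis of the greedy procedure -/

section Greedy

variable {ι : Type*} [DecidableEq ι] {a : (ι → ℝ) → ι} {x : ι → ℕ → ℝ}

/-- The alternative that the greedy procedure observes next. -/
noncomputable abbrev greedyNext (a : (ι → ℝ) → ι) (x : ι → ℕ → ℝ) (t : ℕ) : ι :=
  a (fun i => runningAvg (x i) (greedyCounts a x t i))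

theorem greedyCounts_succ_next (t : ℕ) :
    greedyCounts a x (t + 1) (greedyNext a x t) = greedyCounts a x t (greedyNext a x t) + 1 := by
  simp [greedyCounts, greedyNext]

theorem greedyCounts_succ_of_ne {t : ℕ} {i : ι} (h : i ≠ greedyNext a x t) :
    greedyCounts a x (t + 1) i = greedyCounts a x t i := by
  simp [greedyCounts, Function.update_of_ne h]

theorem one_le_greedyCounts (t : ℕ) (i : ι) : 1 ≤ greedyCounts a x t i := by
  induction t with
  | zero => simp [greedyCounts]
  | succ t ih =>
    by_cases h : i = greedyNext a x t
    · subst h; rw [greedyCounts_succ_next]; omega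
    · rwa [greedyCounts_succ_of_ne h]

theorem greedyCounts_mono (i : ι) : Monotone fun t => greedyCounts a x t i := by
  refine monotone_nat_of_le_succ fun t => ?_
  by_cases h : i = greedyNext a x t
  · subst h; rw [greedyCounts_succ_next]; omega
  · rw [greedyCounts_succ_of_ne h]

theorem sum_greedyCounts [Fintype ι] (t : ℕ) :
    ∑ i, greedyCounts a x t i = Fintype.card ι + t := by
  induction t with
  | zero => simp [greedyCounts]
  | succ t ih =>
    rw [← Finset.add_sum_erase _ _ (Finset.mem_univ (greedyNext a x t))] at ih ⊢
    rw [greedyCounts_succ_next,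
      Finset.sum_congr rfl fun i hi => greedyCounts_succ_of_ne (Finset.ne_of_mem_erase hi)]
    omega

/-- While some alternative has a running average above `b`, the sample size of an alternative does
not go beyond an index at which its running average is at most `b`. -/
theorem greedyCounts_le (ha : IsArgmaxRule a) {b : ℝ} {T : ℕ}
    (h : ∀ t < T, (∀ i m, 1 ≤ m → runningAvg (x i) m ≤ b → greedyCounts a x t i ≤ m) →
      ∃ i, b < runningAvg (x i) (greedyCounts a x t i))
    {t : ℕ} (ht : t ≤ T) (i : ι) {m : ℕ} (hm : 1 ≤ m) (hb : runningAvg (x i) m ≤ b) :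
    greedyCounts a x t i ≤ m := by
  induction t generalizing i m with
  | zero => simpa [greedyCounts] using hm
  | succ t ih =>
    have ih' := fun i m (hm : 1 ≤ m) hb => ih (by omega) i (m := m) hm hb
    obtain ⟨j, hj⟩ := h t ht ih'
    by_cases hi : i = greedyNext a x t
    · subst hi
      -- The next alternative is an argmax, so its current average exceeds `b` and its count is not
      -- yet `m`; one more observation is harmless.
      have h1 := hj.trans_le (ha (fun i => runningAvg (x i) (greedyCounts a x t i)) j)
      rw [greedyCounts_succ_next]
      have h2 := ih' _ m hm hb
      rcases h2.lt_or_eq with h3 | h3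
      · exact h3
      · exact absurd hb (by rw [← h3]; exact not_le.2 h1)
    · rw [greedyCounts_succ_of_ne hi]; exact ih' i m hm hb

theorem greedyCounts_le_of_above (ha : IsArgmaxRule a) {b : ℝ} {T : ℕ} {o : ι}
    (h : ∀ t < T, b < runningAvg (x o) (greedyCounts a x t o))
    {t : ℕ} (ht : t ≤ T) (i : ι) {m : ℕ} (hm : 1 ≤ m) (hb : runningAvg (x i) m ≤ b) :
    greedyCounts a x t i ≤ m :=
  greedyCounts_le ha (fun t ht _ => ⟨o, h t ht⟩) ht i hm hb

/-- If an alternative is observed at a strict future minimum of its running averages, it is the only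
one observed from then on. -/
theorem greedyNext_eq_of_lt (ha : IsArgmaxRule a) {o : ι} {n : ℕ} (hn : 1 ≤ n)
    (hmin : ∀ m, n < m → runningAvg (x o) n < runningAvg (x o) m) {t : ℕ}
    (ht : n < greedyCounts a x t o) : greedyNext a x t = o := by
  -- When `o` is observed at its `n`-th average, no other average exceeds that one; from then on `o`
  -- is strictly ahead and the others are frozen.
  suffices H : ∀ t, n < greedyCounts a x t o → ∀ i, i ≠ o →
      runningAvg (x i) (greedyCounts a x t i) ≤ runningAvg (x o) n by
    by_contra hne
    have h1 := H t ht _ hne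
    have h2 := ha (fun i => runningAvg (x i) (greedyCounts a x t i)) o
    have h3 := hmin _ ht
    exact absurd (h3.trans_le (h2.trans h1)) (lt_irrefl _)
  intro t
  induction t with
  | zero => intro h; simp only [greedyCounts] at h; omega
  | succ t ih =>
    intro h i hi
    by_cases ho : greedyNext a x t = o
    · have hio : i ≠ greedyNext a x t := by rw [ho]; exact hi
      rw [greedyCounts_succ_of_ne hio]
      have h4 := greedyCounts_succ_next (a := a) (x := x) t
      rw [ho] at h4
      rw [h4] at h
      rcases (Nat.lt_succ_iff.1 h).lt_or_eq with h5 | h5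
      · exact ih h5 i hi
      · have h6 := ha (fun i => runningAvg (x i) (greedyCounts a x t i)) i
        change _ ≤ runningAvg (x (greedyNext a x t)) (greedyCounts a x t (greedyNext a x t)) at h6
        rw [ho, ← h5] at h6
        exact h6
    · rw [greedyCounts_succ_of_ne (Ne.symm ho)] at h
      have h1 := ih h _ ho
      have h2 := ha (fun i => runningAvg (x i) (greedyCounts a x t i)) o
      exact absurd ((hmin _ h).trans_le (h2.trans h1)) (lt_irrefl _)

variable [Fintype ι]

/-- A criterion for the selection of `o`: its running averages stay above a level `b` to which all
other alternatives come down within the budget. -/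
theorem greedySelection_eq (ha : IsArgmaxRule a) {o : ι} {b : ℝ} {n B : ℕ} (hn : 1 ≤ n)
    (hB : Fintype.card ι ≤ B)
    (habove : ∀ m, 1 ≤ m → b < runningAvg (x o) m)
    (hmin : ∀ m, n < m → runningAvg (x o) n < runningAvg (x o) m)
    {N : ι → ℕ} (hN : ∀ i, i ≠ o → 1 ≤ N i ∧ runningAvg (x i) (N i) ≤ b)
    (hsum : ∑ i ∈ Finset.univ.erase o, N i + n < B) : greedySelection a x B = o := by
  refine greedyNext_eq_of_lt ha hn hmin ?_
  -- The others use at most `∑ N` observations, so the total `B` forces the count of `o` beyond `n`.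
  have h1 : ∑ i ∈ Finset.univ.erase o, greedyCounts a x (B - Fintype.card ι) i ≤
      ∑ i ∈ Finset.univ.erase o, N i := Finset.sum_le_sum fun i hi =>
    greedyCounts_le_of_above ha (T := B - Fintype.card ι)
      (fun t _ => habove _ (one_le_greedyCounts t o)) le_rfl i
      (hN i (Finset.ne_of_mem_erase hi)).1 (hN i (Finset.ne_of_mem_erase hi)).2
  have h2 := sum_greedyCounts (a := a) (x := x) (B - Fintype.card ι)
  rw [← Finset.add_sum_erase _ _ (Finset.mem_univ o)] at h2
  omega

/-- A criterion for `o` not to be selected: the `n`-th running average of `o` is below a level `b`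
to which the other alternatives do not all come down within the budget, and the earlier
running averages of `o` are above a level `w` to which they do. -/
theorem greedySelection_ne (ha : IsArgmaxRule a) {o : ι} {b w : ℝ} {n B : ℕ} (hn : 1 ≤ n)
    (hB : Fintype.card ι ≤ B)
    (hbelow : runningAvg (x o) n ≤ b)
    (habove : ∀ m, 1 ≤ m → m < n → w < runningAvg (x o) m)
    {N M : ι → ℕ} (hN : ∀ i, i ≠ o → IsFirstPassage b (x i) (N i))
    (hM : ∀ i, i ≠ o → 1 ≤ M i ∧ runningAvg (x i) (M i) ≤ w)
    (hNsum : B ≤ ∑ i ∈ Finset.univ.erase o, N i)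
    (hMsum : ∑ i ∈ Finset.univ.erase o, M i + n ≤ B) : greedySelection a x B ≠ o := by
  -- At least one of the at most `B` observations belongs to `o`, so the others hold fewer than `B ≤
  -- ∑ N`.
  have key : ∀ t ≤ B - Fintype.card ι, ∃ i, i ≠ o ∧ greedyCounts a x t i < N i := by
    intro t ht
    by_contra! hcon
    have h1 : ∑ i ∈ Finset.univ.erase o, N i ≤ ∑ i ∈ Finset.univ.erase o, greedyCounts a x t i :=
      Finset.sum_le_sum fun i hi => hcon i (Finset.ne_of_mem_erase hi)
    have h2 := sum_greedyCounts (a := a) (x := x) t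
    rw [← Finset.add_sum_erase _ _ (Finset.mem_univ o)] at h2
    have := one_le_greedyCounts (a := a) (x := x) t o
    omega
  have key' : ∀ t ≤ B - Fintype.card ι, ∃ i, b < runningAvg (x i) (greedyCounts a x t i) := by
    intro t ht
    obtain ⟨i, hi, hlt⟩ := key t ht
    exact ⟨i, (hN i hi).2.2 _ (one_le_greedyCounts t i) hlt⟩
  have h1 : greedyCounts a x (B - Fintype.card ι) o ≤ n :=
    greedyCounts_le ha (fun t ht _ => key' t ht.le) le_rfl o hn hbelow
  have h2 : n ≤ greedyCounts a x (B - Fintype.card ι) o := by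
    -- If `o` had fewer than `n` observations, all its averages so far would exceed `w` (the last
    -- one is not needed), so the others would use at most `∑ M` and leave at least `n` to `o`.
    by_contra! hlt
    have h3 : ∑ i ∈ Finset.univ.erase o, greedyCounts a x (B - Fintype.card ι) i ≤
        ∑ i ∈ Finset.univ.erase o, M i := Finset.sum_le_sum fun i hi =>
      greedyCounts_le_of_above ha (T := B - Fintype.card ι)
        (fun t ht => habove _ (one_le_greedyCounts t o)
          ((greedyCounts_mono o ht.le).trans_lt hlt)) le_rfl i
        (hM i (Finset.ne_of_mem_erase hi)).1 (hM i (Finset.ne_of_mem_erase hi)).2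
    have h2 := sum_greedyCounts (a := a) (x := x) (B - Fintype.card ι)
    rw [← Finset.add_sum_erase _ _ (Finset.mem_univ o)] at h2
    omega
  intro hsel
  -- `o` ends exactly at its `n`-th average, at most `b`, whereas a selected alternative must be
  -- above `b`.
  obtain ⟨i, hi⟩ := key' _ le_rfl
  have h4 := hi.trans_le (ha (fun i => runningAvg (x i) (greedyCounts a x (B - Fintype.card ι) i)) i)
  change b < runningAvg (x (greedySelection a x B)) (greedyCounts a x _ (greedySelection a x B)) at h4
  rw [hsel, le_antisymm h1 h2] at h4
  exact absurd h4 (not_lt.2 hbelow)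

end Greedy

/-! ### Random walks and the time of their first maximum -/

/-- The random walk with steps `z j - x`. -/
def driftWalk (x : ℝ) (z : ℕ → ℝ) (n : ℕ) : ℝ := ∑ j ∈ Finset.range n, (z j - x)

/-- The law of a sequence of independent variables with common distribution `ρ`. -/
noncomputable abbrev iidLaw (ρ : Measure ℝ) : Measure (ℕ → ℝ) := Measure.infinitePi fun _ => ρ

/-- The walk is positive at the times `1, …, n`. -/
def stayPos (x : ℝ) (n : ℕ) : Set (ℕ → ℝ) := {z | ∀ m, 1 ≤ m → m ≤ n → 0 < driftWalk x z m}

/-- The walk is not positive at the times `1, …, n`. -/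
def stayNonpos (x : ℝ) (n : ℕ) : Set (ℕ → ℝ) := {z | ∀ m, 1 ≤ m → m ≤ n → driftWalk x z m ≤ 0}

/-- Among the times `0, …, n`, the walk attains its maximum at time `k` for the first time. -/
def firstMaxAt (x : ℝ) (n k : ℕ) : Set (ℕ → ℝ) :=
  {z | k ≤ n ∧ (∀ j < k, driftWalk x z j < driftWalk x z k) ∧
    ∀ j, k < j → j ≤ n → driftWalk x z j ≤ driftWalk x z k}

section Walk

variable {x : ℝ} {z z' : ℕ → ℝ} {n k m : ℕ}

@[simp]
theorem driftWalk_zero : driftWalk x z 0 = 0 := by simp [driftWalk]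

theorem driftWalk_succ : driftWalk x z (n + 1) = driftWalk x z n + (z n - x) := by
  rw [driftWalk, Finset.sum_range_succ, driftWalk]

theorem driftWalk_congr (h : ∀ j < n, z j = z' j) : driftWalk x z n = driftWalk x z' n :=
  Finset.sum_congr rfl fun j hj => by rw [h j (Finset.mem_range.1 hj)]

theorem driftWalk_add :
    driftWalk x z (k + m) = driftWalk x z k + driftWalk x (fun j => z (k + j)) m := by
  rw [driftWalk, Finset.sum_range_add, driftWalk, driftWalk]

@[fun_prop]
theorem measurable_driftWalk (x : ℝ) (n : ℕ) : Measurable fun z => driftWalk x z n := by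
  unfold driftWalk; fun_prop

theorem measurableSet_stayPos (x : ℝ) (n : ℕ) : MeasurableSet (stayPos x n) := by
  simp only [stayPos, Set.ofPred_forall]
  exact .iInter fun m => .iInter fun _ => .iInter fun _ =>
    measurableSet_lt measurable_const (by fun_prop)

theorem measurableSet_stayNonpos (x : ℝ) (n : ℕ) : MeasurableSet (stayNonpos x n) := by
  simp only [stayNonpos, Set.ofPred_forall]
  exact .iInter fun m => .iInter fun _ => .iInter fun _ =>
    measurableSet_le (by fun_prop) measurable_const

theorem measurableSet_firstMaxAt (x : ℝ) (n k : ℕ) : MeasurableSet (firstMaxAt x n k) := by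
  simp only [firstMaxAt, Set.ofPred_and, Set.ofPred_forall]
  refine .inter (.const _) (.inter (.iInter fun j => .iInter fun _ => ?_)
    (.iInter fun j => .iInter fun _ => .iInter fun _ => ?_))
  · exact measurableSet_lt (by fun_prop) (by fun_prop)
  · exact measurableSet_le (by fun_prop) (by fun_prop)

theorem firstMaxAt_congr (h : ∀ j < n, z j = z' j) : z ∈ firstMaxAt x n k ↔ z' ∈ firstMaxAt x n k := by
  have hw : ∀ j ≤ n, driftWalk x z j = driftWalk x z' j := fun j hj =>
    driftWalk_congr fun i hi => h i (hi.trans_le hj)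
  simp only [firstMaxAt, Set.mem_ofPred_eq]
  refine and_congr_right fun hk => and_congr (forall₂_congr fun j hj => ?_)
    (forall₃_congr fun j _ hj => ?_)
  · rw [hw j (hj.le.trans hk), hw k hk]
  · rw [hw j hj, hw k hk]

theorem exists_mem_firstMaxAt (x : ℝ) (z : ℕ → ℝ) (n : ℕ) : ∃ k ≤ n, z ∈ firstMaxAt x n k := by
  induction n with
  | zero => exact ⟨0, le_rfl, le_rfl, by simp, fun j h1 h2 => by omega⟩
  | succ n ih =>
    obtain ⟨k, hk, -, h1, h2⟩ := ih
    by_cases h : driftWalk x z k < driftWalk x z (n + 1)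
    · refine ⟨n + 1, le_rfl, le_rfl, fun j hj => ?_, fun j h1 h2 => by omega⟩
      rcases lt_trichotomy j k with hjk | rfl | hjk
      · exact (h1 j hjk).trans h
      · exact h
      · exact (h2 j hjk (by omega)).trans_lt h
    · refine ⟨k, by omega, by omega, h1, fun j hj hjn => ?_⟩
      rcases hjn.lt_or_eq with h3 | rfl
      · exact h2 j hj (by omega)
      · exact not_lt.1 h

theorem firstMaxAt_disjoint (x : ℝ) (n : ℕ) : Pairwise (Function.onFun Disjoint (firstMaxAt x n)) := by
  have key : ∀ k l, k < l → ∀ z, z ∈ firstMaxAt x n k → z ∈ firstMaxAt x n l → False := by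
    intro k l hkl z hz hz'
    exact absurd (hz'.2.1 k hkl) (not_lt.2 (hz.2.2 l hkl hz'.1))
  intro k l hkl
  refine Set.disjoint_left.2 fun z hz hz' => ?_
  rcases lt_or_gt_of_ne hkl with h | h
  · exact key k l h z hz hz'
  · exact key l k h z hz' hz

/-- The maximum is at least the starting value 0, so a nonpositive end point neither beats it nor
becomes a first maximum. -/
theorem firstMaxAt_succ_of_nonpos (h : driftWalk x z (n + 1) ≤ 0) :
    z ∈ firstMaxAt x (n + 1) k ↔ z ∈ firstMaxAt x n k := by
  constructor
  · rintro ⟨h0, h1, h2⟩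
    have hk : k ≤ n := by
      by_contra hk
      obtain rfl : k = n + 1 := by omega
      have := h1 0 (by omega)
      simp only [driftWalk_zero] at this
      linarith
    exact ⟨hk, h1, fun j hj hjn => h2 j hj (by omega)⟩
  · rintro ⟨h0, h1, h2⟩
    refine ⟨by omega, h1, fun j hj hjn => ?_⟩
    rcases hjn.lt_or_eq with h3 | rfl
    · exact h2 j hj (by omega)
    · refine h.trans ?_
      rcases Nat.eq_zero_or_pos k with rfl | hk
      · simp
      · simpa using (h1 0 hk).le

/-- A positive end point rules out a maximum at time 0, so the walk may be restarted at time 1,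
which lowers the index by one. -/
theorem firstMaxAt_succ_succ_of_pos (h : 0 < driftWalk x z (n + 1)) :
    z ∈ firstMaxAt x (n + 1) (k + 1) ↔ (fun j => z (j + 1)) ∈ firstMaxAt x n k := by
  have hw : ∀ j, driftWalk x z (j + 1) = (z 0 - x) + driftWalk x (fun i => z (i + 1)) j := by
    intro j
    rw [add_comm j 1, driftWalk_add]
    simp [driftWalk, add_comm]
  constructor
  · rintro ⟨h0, h1, h2⟩
    refine ⟨by omega, fun j hj => ?_, fun j hj hjn => ?_⟩
    · have := h1 (j + 1) (by omega)
      rw [hw, hw] at this; linarith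
    · have := h2 (j + 1) (by omega) (by omega)
      rw [hw, hw] at this; linarith
  · rintro ⟨h0, h1, h2⟩
    have h2' : ∀ j, k + 1 < j → j ≤ n + 1 → driftWalk x z j ≤ driftWalk x z (k + 1) := by
      intro j hj hjn
      obtain ⟨i, rfl⟩ : ∃ i, j = i + 1 := ⟨j - 1, by omega⟩
      rw [hw, hw]; linarith [h2 i (by omega) (by omega)]
    refine ⟨by omega, fun j hj => ?_, h2'⟩
    rcases Nat.eq_zero_or_pos j with rfl | hj0
    · rw [driftWalk_zero]
      rcases h0.lt_or_eq with h3 | rfl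
      · exact h.trans_le (h2' (n + 1) (by omega) le_rfl)
      · exact h
    · obtain ⟨i, rfl⟩ : ∃ i, j = i + 1 := ⟨j - 1, by omega⟩
      rw [hw, hw]; linarith [h1 i (by omega)]

end Walk

/-! ### The Sparre Andersen recursion -/

section Law

variable (ρ : Measure ℝ) [IsProbabilityMeasure ρ] (x : ℝ)

theorem measurePreserving_comp_iidLaw {f : ℕ → ℕ} (hf : Function.Injective f) :
    MeasurePreserving (fun (z : ℕ → ℝ) i => z (f i)) (iidLaw ρ) (iidLaw ρ) :=
  ⟨by fun_prop, Measure.map_infinitePi_infinitePi_of_inj hf⟩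

/-- Events that are determined by disjoint finite sets of coordinates are independent. -/
theorem iidLaw_real_inter_of_disjoint {A B : Set (ℕ → ℝ)} (hA : MeasurableSet A)
    (hB : MeasurableSet B) {s t : Finset ℕ} (hst : Disjoint s t)
    (hAs : ∀ z z' : ℕ → ℝ, (∀ i ∈ s, z i = z' i) → (z ∈ A ↔ z' ∈ A))
    (hBt : ∀ z z' : ℕ → ℝ, (∀ i ∈ t, z i = z' i) → (z ∈ B ↔ z' ∈ B)) :
    (iidLaw ρ).real (A ∩ B) = (iidLaw ρ).real A * (iidLaw ρ).real B := by
  have hind : iIndepFun (fun (i : ℕ) (z : ℕ → ℝ) => z i) (iidLaw ρ) :=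
    iIndepFun_infinitePi (P := fun _ : ℕ => ρ) (X := fun _ y => y) fun _ => measurable_id
  have h2 := hind.indepFun_finset s t hst fun i => by fun_prop
  -- Padding a finite block of coordinates by zeros turns an event determined by the block into a
  -- preimage under it; the padding value is immaterial.
  let ext (u : Finset ℕ) (v : u → ℝ) (j : ℕ) : ℝ := if h : j ∈ u then v ⟨j, h⟩ else 0
  have hext : ∀ u, Measurable (ext u) := fun u => by
    refine measurable_pi_iff.2 fun j => ?_
    by_cases h : j ∈ u
    · simp only [ext, h, dif_pos]; fun_prop
    · simp only [ext, h, dif_neg, not_false_eq_true]; fun_prop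
  have hext' : ∀ (u : Finset ℕ) (z : ℕ → ℝ), ∀ i ∈ u, ext u (fun i : u => z i) i = z i :=
    fun u z i hi => by simp [ext, hi]
  have hA' : A = (fun (z : ℕ → ℝ) (i : s) => z i) ⁻¹' (ext s ⁻¹' A) := by
    ext z; exact (hAs _ _ (hext' s z)).symm
  have hB' : B = (fun (z : ℕ → ℝ) (i : t) => z i) ⁻¹' (ext t ⁻¹' B) := by
    ext z; exact (hBt _ _ (hext' t z)).symm
  have h3 := h2.measure_inter_preimage_eq_mul _ _ (hext s hA) (hext t hB)
  rw [← hA', ← hB'] at h3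
  simp [measureReal_def, h3, ENNReal.toReal_mul]

/-- The probability that the maximum over `0, …, n` is first attained at `k` splits into the
probability of a new maximum at `k` and that of no new maximum in `n - k` further steps. -/
theorem iidLaw_real_firstMaxAt (k m : ℕ) :
    (iidLaw ρ).real (firstMaxAt x (k + m) k) =
      (iidLaw ρ).real (stayPos x k) * (iidLaw ρ).real (stayNonpos x m) := by
  -- Reversing the first `k` steps turns "time `k` beats all earlier times" into "the walk is
  -- positive at times 1 to `k`" without changing the law.
  let rev : ℕ → ℕ := fun j => if j < k then k - 1 - j else j
  have hrev : Function.Injective rev := by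
    intro i j h
    simp only [rev] at h
    split_ifs at h <;> omega
  have hshift : Function.Injective fun j => k + j := add_right_injective k
  have h1 := (measurePreserving_comp_iidLaw ρ hrev).measureReal_preimage
    (measurableSet_stayPos x k).nullMeasurableSet
  have h2 := (measurePreserving_comp_iidLaw ρ hshift).measureReal_preimage
    (measurableSet_stayNonpos x m).nullMeasurableSet
  have hwrev : ∀ (z : ℕ → ℝ) (i : ℕ), i ≤ k →
      driftWalk x (fun j => z (rev j)) i = driftWalk x z k - driftWalk x z (k - i) := by
    intro z i hi
    induction i with
    | zero => simp
    | succ i ih =>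
      rw [driftWalk_succ, ih (by omega)]
      have hk : k - i = (k - (i + 1)) + 1 := by omega
      have hr : rev i = k - (i + 1) := by simp only [rev]; split_ifs <;> omega
      rw [hk, driftWalk_succ, hr]
      ring
  rw [← h1, ← h2, ← iidLaw_real_inter_of_disjoint ρ (s := Finset.range k)
    (t := Finset.Ico k (k + m))]
  · congr 1
    ext z
    simp only [firstMaxAt, stayPos, stayNonpos, Set.mem_ofPred_eq, Set.mem_inter_iff,
      Set.mem_preimage]
    constructor
    · rintro ⟨-, h3, h4⟩
      refine ⟨fun i hi hik => ?_, fun i hi him => ?_⟩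
      · rw [hwrev z i hik]; linarith [h3 (k - i) (by omega)]
      · have := h4 (k + i) (by omega) (by omega)
        rw [driftWalk_add] at this; linarith
    · rintro ⟨h3, h4⟩
      refine ⟨by omega, fun j hj => ?_, fun j hj hjn => ?_⟩
      · have := h3 (k - j) (by omega) (by omega)
        rw [hwrev z _ (by omega), show k - (k - j) = j by omega] at this; linarith
      · obtain ⟨i, rfl⟩ := Nat.exists_eq_add_of_lt hj
        rw [show k + i + 1 = k + (i + 1) by ring, driftWalk_add]
        linarith [h4 (i + 1) (by omega) (by omega)]
  · exact (measurePreserving_comp_iidLaw ρ hrev).measurable (measurableSet_stayPos x k)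
  · exact (measurePreserving_comp_iidLaw ρ hshift).measurable (measurableSet_stayNonpos x m)
  · refine Finset.disjoint_left.2 fun i hi hi' => ?_
    simp at hi hi'; omega
  · intro z z' h
    simp only [stayPos, Set.mem_preimage, Set.mem_ofPred_eq]
    refine forall₃_congr fun i _ hi => ?_
    rw [driftWalk_congr fun j hj => h (rev j) ?_]
    simp only [rev, Finset.mem_range]; split_ifs <;> omega
  · intro z z' h
    simp only [stayNonpos, Set.mem_preimage, Set.mem_ofPred_eq]
    refine forall₃_congr fun i _ hi => ?_
    rw [driftWalk_congr fun j hj => h (k + j) ?_]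
    simp only [Finset.mem_Ico]; omega

theorem sum_iidLaw_real_firstMaxAt_inter (n : ℕ) {A : Set (ℕ → ℝ)} (hA : MeasurableSet A) :
    ∑ k ∈ Finset.range (n + 1), (iidLaw ρ).real (firstMaxAt x n k ∩ A) = (iidLaw ρ).real A := by
  rw [← measureReal_biUnion_finset]
  · congr 1
    ext z
    simp only [Set.mem_iUnion, Set.mem_inter_iff, exists_prop, Finset.mem_range]
    constructor
    · rintro ⟨k, -, -, h⟩; exact h
    · intro h
      obtain ⟨k, hk, hz⟩ := exists_mem_firstMaxAt x z n
      exact ⟨k, by omega, hz, h⟩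
  · intro k _ l _ hkl
    exact (firstMaxAt_disjoint x n hkl).mono Set.inter_subset_left Set.inter_subset_left
  · exact fun k _ => (measurableSet_firstMaxAt x n k).inter hA

theorem sum_stayPos_mul_stayNonpos (n : ℕ) :
    ∑ k ∈ Finset.range (n + 1),
      (iidLaw ρ).real (stayPos x k) * (iidLaw ρ).real (stayNonpos x (n - k)) = 1 := by
  have h := sum_iidLaw_real_firstMaxAt_inter ρ x n MeasurableSet.univ
  simp only [Set.inter_univ, probReal_univ] at h
  rw [← h]
  refine Finset.sum_congr rfl fun k hk => ?_
  obtain ⟨m, rfl⟩ := Nat.exists_eq_add_of_le (Nat.lt_succ_iff.1 (Finset.mem_range.1 hk))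
  rw [iidLaw_real_firstMaxAt, Nat.add_sub_cancel_left]

/-- The expected time of the first maximum grows by the probability of a positive end point. -/
theorem sum_mul_iidLaw_real_firstMaxAt_succ (n : ℕ) :
    ∑ k ∈ Finset.range (n + 2), (k : ℝ) * (iidLaw ρ).real (firstMaxAt x (n + 1) k) =
      ∑ k ∈ Finset.range (n + 1), (k : ℝ) * (iidLaw ρ).real (firstMaxAt x n k) +
        (iidLaw ρ).real {z | 0 < driftWalk x z (n + 1)} := by
  set A : Set (ℕ → ℝ) := {z | 0 < driftWalk x z (n + 1)} with hAdef
  have hA : MeasurableSet A := measurableSet_lt measurable_const (by fun_prop)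
  have hsplit : ∀ j k, (iidLaw ρ).real (firstMaxAt x j k) =
      (iidLaw ρ).real (firstMaxAt x j k ∩ A) + (iidLaw ρ).real (firstMaxAt x j k \ A) :=
    fun j k => (measureReal_inter_add_sdiff hA).symm
  have hneg : ∀ k, firstMaxAt x (n + 1) k \ A = firstMaxAt x n k \ A := by
    intro k; ext z
    simp only [Set.mem_sdiff, hAdef, Set.mem_ofPred_eq, not_lt]
    exact and_congr_left fun h => firstMaxAt_succ_of_nonpos h
  have htop : firstMaxAt x n (n + 1) = ∅ := by
    ext z; simp only [Set.mem_empty_iff_false, iff_false]; intro h; have := h.1; omega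
  -- Cyclic shift of the first `n + 1` steps: it preserves the law and the end point, and turns the
  -- walk restarted at time 1 into an initial segment.
  let cyc : ℕ → ℕ := fun j => if j < n then j + 1 else if j = n then 0 else j
  have hcyc : Function.Injective cyc := by
    intro i j h
    simp only [cyc] at h
    split_ifs at h <;> omega
  have hcyc_sum : ∀ z : ℕ → ℝ, driftWalk x (fun j => z (cyc j)) (n + 1) = driftWalk x z (n + 1) := by
    intro z
    rw [driftWalk_succ]
    have h1 : driftWalk x (fun j => z (cyc j)) n = driftWalk x (fun j => z (1 + j)) n :=
      driftWalk_congr fun j hj => by simp [cyc, hj, add_comm]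
    rw [h1, add_comm n 1, driftWalk_add]
    simp [cyc, driftWalk, add_comm]
  have hpos : ∀ k, (iidLaw ρ).real (firstMaxAt x (n + 1) (k + 1) ∩ A) =
      (iidLaw ρ).real (firstMaxAt x n k ∩ A) := by
    intro k
    rw [← (measurePreserving_comp_iidLaw ρ hcyc).measureReal_preimage
      ((measurableSet_firstMaxAt x n k).inter hA).nullMeasurableSet]
    congr 1
    ext z
    simp only [Set.mem_inter_iff, Set.mem_preimage, hAdef, Set.mem_ofPred_eq, hcyc_sum]
    refine and_congr_left fun h => ?_
    rw [firstMaxAt_succ_succ_of_pos h]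
    exact firstMaxAt_congr fun j hj => by simp [cyc, hj]
  have hneg_sum : ∑ k ∈ Finset.range (n + 2), (k : ℝ) * (iidLaw ρ).real (firstMaxAt x n k \ A) =
      ∑ k ∈ Finset.range (n + 1), (k : ℝ) * (iidLaw ρ).real (firstMaxAt x n k \ A) := by
    rw [Finset.sum_range_succ, htop]; simp
  -- On a positive end point the index rises by one, so the mean gains exactly the probability of
  -- `A`.
  have hpos_sum : ∑ k ∈ Finset.range (n + 2), (k : ℝ) * (iidLaw ρ).real (firstMaxAt x (n + 1) k ∩ A)
      = ∑ k ∈ Finset.range (n + 1), ((k : ℝ) * (iidLaw ρ).real (firstMaxAt x n k ∩ A) +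
        (iidLaw ρ).real (firstMaxAt x n k ∩ A)) := by
    rw [Finset.sum_range_succ']
    simp only [hpos, Nat.cast_zero, zero_mul, add_zero]
    exact Finset.sum_congr rfl fun k _ => by push_cast; ring
  simp_rw [hsplit (n + 1), hsplit n, mul_add, Finset.sum_add_distrib, hneg]
  rw [hneg_sum, hpos_sum, Finset.sum_add_distrib, sum_iidLaw_real_firstMaxAt_inter ρ x n hA]
  ring

theorem sum_mul_stayPos_mul_stayNonpos (n : ℕ) :
    ∑ k ∈ Finset.range (n + 1),
      (k : ℝ) * ((iidLaw ρ).real (stayPos x k) * (iidLaw ρ).real (stayNonpos x (n - k))) =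
      ∑ k ∈ Finset.range (n + 1), (iidLaw ρ).real {z | 0 < driftWalk x z k} := by
  have h1 : ∀ n, ∑ k ∈ Finset.range (n + 1), (k : ℝ) * (iidLaw ρ).real (firstMaxAt x n k) =
      ∑ k ∈ Finset.range (n + 1), (iidLaw ρ).real {z | 0 < driftWalk x z k} := by
    intro n
    induction n with
    | zero => simp
    | succ n ih => rw [sum_mul_iidLaw_real_firstMaxAt_succ, ih, ← Finset.sum_range_succ]
  rw [← h1]
  refine Finset.sum_congr rfl fun k hk => ?_
  obtain ⟨m, rfl⟩ := Nat.exists_eq_add_of_le (Nat.lt_succ_iff.1 (Finset.mem_range.1 hk))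
  rw [iidLaw_real_firstMaxAt, Nat.add_sub_cancel_left]

open PowerSeries in
/-- The Sparre Andersen recursion for the probabilities that the walk stays positive. -/
theorem succ_mul_stayPos_succ (n : ℕ) :
    ((n : ℝ) + 1) * (iidLaw ρ).real (stayPos x (n + 1)) =
      ∑ k ∈ Finset.range (n + 1), (iidLaw ρ).real {z | 0 < driftWalk x z (k + 1)} *
        (iidLaw ρ).real (stayPos x (n - k)) := by
  set p : ℕ → ℝ := fun n => (iidLaw ρ).real (stayPos x n)
  set q : ℕ → ℝ := fun n => (iidLaw ρ).real (stayNonpos x n)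
  set a : ℕ → ℝ := fun n => (iidLaw ρ).real {z | 0 < driftWalk x z n}
  let u : PowerSeries ℝ := mk fun _ => 1
  -- For the generating functions P, Q, A of `p`, `q`, `a`: PQ = 1/(1-z) by total probability, and
  -- zP'Q = A/(1-z) by the mean time of the first maximum. Cancelling gives zP' = AP.
  have hpq : (mk p : PowerSeries ℝ) * mk q = u := by
    ext n
    simp only [coeff_mul, coeff_mk, u]
    rw [Finset.Nat.sum_antidiagonal_eq_sum_range_succ (fun i j => p i * q j)]
    exact sum_stayPos_mul_stayNonpos ρ x n
  have hdpq : (mk fun n => (n : ℝ) * p n : PowerSeries ℝ) * mk q = mk a * u := by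
    ext n
    simp only [coeff_mul, coeff_mk, u, mul_one]
    rw [Finset.Nat.sum_antidiagonal_eq_sum_range_succ (fun i j => (i : ℝ) * p i * q j),
      Finset.Nat.sum_antidiagonal_eq_sum_range_succ (fun i j => a i)]
    simpa only [mul_assoc] using sum_mul_stayPos_mul_stayNonpos ρ x n
  have hu : u * (1 - X) = 1 := mk_one_mul_one_sub_eq_one ℝ
  have hrec : (mk fun n => (n : ℝ) * p n : PowerSeries ℝ) = mk a * mk p := by
    calc (mk fun n => (n : ℝ) * p n : PowerSeries ℝ)
        = (mk fun n => (n : ℝ) * p n) * (u * (1 - X)) := by rw [hu, mul_one]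
      _ = ((mk fun n => (n : ℝ) * p n) * mk q) * mk p * (1 - X) := by rw [← hpq]; ring
      _ = mk a * mk p * (u * (1 - X)) := by rw [hdpq]; ring
      _ = mk a * mk p := by rw [hu, mul_one]
  have h := congrArg (coeff (n + 1)) hrec
  simp only [coeff_mul, coeff_mk] at h
  rw [Finset.Nat.sum_antidiagonal_eq_sum_range_succ (fun i j => a i * p j),
    Finset.sum_range_succ'] at h
  have ha0 : a 0 = 0 := by simp [a]
  simp only [ha0, zero_mul, add_zero, Nat.add_sub_add_right] at h
  push_cast at h
  exact h

end Law

/-! ### Solving the recursion: generating functions and Abel limits -/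

section GeneratingFunction

theorem summable_mul_pow_of_abs_le_one {c : ℕ → ℝ} (hc : ∀ n, |c n| ≤ 1) {z : ℝ} (hz : |z| < 1) :
    Summable fun n => ‖c n * z ^ n‖ := by
  refine Summable.of_nonneg_of_le (fun n => norm_nonneg _) (fun n => ?_)
    (summable_geometric_of_lt_one (abs_nonneg z) hz)
  rw [norm_mul, norm_pow, Real.norm_eq_abs, Real.norm_eq_abs]
  exact mul_le_of_le_one_left (by positivity) (hc n)

theorem hasDerivAt_tsum_mul_pow {c : ℕ → ℝ} (hc : ∀ n, |c n| ≤ 1) {z : ℝ} (hz : |z| < 1) :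
    HasDerivAt (fun y => ∑' n, c n * y ^ n) (∑' n : ℕ, ((n : ℝ) + 1) * c (n + 1) * z ^ n) z := by
  obtain ⟨r, hzr, hr1⟩ := exists_between hz
  have hr0 : 0 < r := (abs_nonneg z).trans_lt hzr
  have hu : Summable fun n : ℕ => (n : ℝ) * r ^ (n - 1) := by
    have h1 : Summable fun n : ℕ => (n : ℝ) ^ 1 * r ^ n :=
      summable_pow_mul_geometric_of_norm_lt_one 1 (by rwa [Real.norm_of_nonneg hr0.le])
    refine (h1.mul_right r⁻¹).congr fun n => ?_
    rcases n with _ | n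
    · simp
    · simp only [Nat.add_sub_cancel, pow_succ]; field_simp
  have h := hasDerivAt_tsum_of_isPreconnected (t := Metric.ball (0 : ℝ) r) (y₀ := 0) (y := z)
    (g := fun n y => c n * y ^ n) (g' := fun n y => c n * (n * y ^ (n - 1))) hu
    Metric.isOpen_ball (convex_ball 0 r).isPreconnected
    (fun n y _ => (hasDerivAt_pow n y).const_mul (c n)) (fun n y hy => ?_) (by simpa using hr0)
    (summable_of_ne_finset_zero (s := {0}) fun n hn => ?_) (by simpa using hzr)
  · convert! h using 1
    have hs : Summable fun n : ℕ => c n * (n * z ^ (n - 1)) := by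
      refine Summable.of_norm_bounded hu fun n => ?_
      rw [norm_mul, norm_mul, norm_pow, Real.norm_eq_abs, Real.norm_eq_abs, Real.norm_eq_abs,
        Nat.abs_cast]
      refine (mul_le_of_le_one_left (by positivity) (hc n)).trans ?_
      gcongr
    rw [hs.tsum_eq_zero_add]
    simp only [Nat.cast_zero, zero_mul, mul_zero, zero_add, Nat.add_sub_cancel]
    refine tsum_congr fun n => ?_
    push_cast; ring
  · rw [mem_ball_zero_iff, Real.norm_eq_abs] at hy
    rw [norm_mul, norm_mul, norm_pow, Real.norm_eq_abs, Real.norm_eq_abs, Real.norm_eq_abs,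
      Nat.abs_cast]
    refine (mul_le_of_le_one_left (by positivity) (hc n)).trans ?_
    gcongr
  · simp only [Finset.mem_singleton] at hn
    simp [hn]

variable {p a : ℕ → ℝ}

/-- The generating function of a sequence that satisfies the Sparre Andersen recursion. -/
theorem tsum_mul_pow_eq_exp (hp0 : p 0 = 1) (hp : ∀ n, |p n| ≤ 1) (ha : ∀ n, |a n| ≤ 1)
    (hrec : ∀ n : ℕ, ((n : ℝ) + 1) * p (n + 1) = ∑ k ∈ Finset.range (n + 1), a k * p (n - k))
    {z : ℝ} (hz : |z| < 1) :
    ∑' n, p n * z ^ n = Real.exp (∑' n : ℕ, a n / ((n : ℝ) + 1) * z ^ (n + 1)) := by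
  let b : ℕ → ℝ := fun n => if n = 0 then 0 else a (n - 1) / n
  have hb : ∀ n, |b n| ≤ 1 := by
    intro n
    rcases n with _ | n
    · simp [b]
    · simp only [b, Nat.add_sub_cancel, if_neg (Nat.succ_ne_zero n), abs_div, Nat.abs_cast]
      rw [div_le_one (by positivity)]
      refine (ha n).trans ?_
      push_cast; linarith [Nat.cast_nonneg (α := ℝ) n]
  have hb' : ∀ n : ℕ, b (n + 1) = a n / ((n : ℝ) + 1) := fun n => by simp [b]
  -- With F the series of `p`, A that of `a` and L that of `b`, the recursion reads F' = AF, while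
  -- L' = A; hence F exp(-L) is constant.
  have hderiv : ∀ y ∈ Metric.ball (0 : ℝ) 1, HasDerivAt
      (fun y => (∑' n, p n * y ^ n) * Real.exp (-∑' n, b n * y ^ n)) 0 y := by
    intro y hy
    rw [mem_ball_zero_iff, Real.norm_eq_abs] at hy
    have h1 := hasDerivAt_tsum_mul_pow hp hy
    have h2 := hasDerivAt_tsum_mul_pow hb hy
    have h3 : ∑' n : ℕ, ((n : ℝ) + 1) * p (n + 1) * y ^ n =
        (∑' n, a n * y ^ n) * ∑' n, p n * y ^ n := by
      rw [tsum_mul_tsum_eq_tsum_sum_range_of_summable_norm (summable_mul_pow_of_abs_le_one ha hy)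
        (summable_mul_pow_of_abs_le_one hp hy)]
      refine tsum_congr fun n => ?_
      rw [hrec, Finset.sum_mul]
      refine Finset.sum_congr rfl fun k hk => ?_
      have hkn : k ≤ n := Nat.lt_succ_iff.1 (Finset.mem_range.1 hk)
      rw [← pow_mul_pow_sub y hkn]; ring
    have h4 : ∑' n : ℕ, ((n : ℝ) + 1) * b (n + 1) * y ^ n = ∑' n, a n * y ^ n := by
      refine tsum_congr fun n => ?_
      rw [hb']; field_simp
    rw [h3] at h1
    rw [h4] at h2
    convert! h1.mul h2.neg.exp using 1
    ring
  have hconst := Metric.isOpen_ball.is_const_of_deriv_eq_zero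
    (convex_ball (0 : ℝ) 1).isPreconnected
    (fun y hy => (hderiv y hy).differentiableAt.differentiableWithinAt)
    (fun y hy => (hderiv y hy).deriv) (x := z) (y := 0) (by simpa using hz) (by simp)
  have hp_zero : ∑' n, p n * (0 : ℝ) ^ n = 1 := by
    rw [tsum_eq_single 0 fun n hn => by simp [hn]]; simp [hp0]
  have hb_zero : ∑' n, b n * (0 : ℝ) ^ n = 0 := by
    rw [tsum_eq_single 0 fun n hn => by simp [hn]]; simp [b]
  simp only [hp_zero, hb_zero, neg_zero, Real.exp_zero, mul_one] at hconst
  rw [Real.exp_neg, mul_inv_eq_one₀ (Real.exp_ne_zero _)] at hconst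
  rw [hconst, (summable_mul_pow_of_abs_le_one hb hz).of_norm.tsum_eq_zero_add]
  simp only [hb']
  simp [b]

theorem tendsto_tsum_mul_pow_succ {c : ℕ → ℝ} (hc : Summable c) :
    Tendsto (fun z : ℝ => ∑' n, c n * z ^ (n + 1)) (𝓝[<] 1) (𝓝 (∑' n, c n)) := by
  have h1 := Real.tendsto_tsum_powerSeries_nhdsWithin_lt hc.hasSum.tendsto_sum_nat
  have h2 : Tendsto (fun z : ℝ => z) (𝓝[<] 1) (𝓝 1) := tendsto_nhdsWithin_of_tendsto_nhds tendsto_id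
  have h3 := h2.mul h1
  rw [one_mul] at h3
  refine h3.congr fun z => ?_
  rw [← tsum_mul_left]
  exact tsum_congr fun n => by ring

theorem eventually_abs_lt_one : ∀ᶠ z : ℝ in 𝓝[<] 1, 0 < z ∧ |z| < 1 := by
  filter_upwards [Ioo_mem_nhdsLT (zero_lt_one (α := ℝ))] with z hz
  exact ⟨hz.1, by rw [abs_of_pos hz.1]; exact hz.2⟩

/-- Nonnegativity lets z → 1 bound every partial sum of `p`, which gives summability; Abel's theorem
then identifies the sum. This is the case of negative drift. -/
theorem hasSum_exp_of_recursion (hp0 : p 0 = 1) (hp : ∀ n, 0 ≤ p n ∧ p n ≤ 1)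
    (ha : ∀ n, 0 ≤ a n ∧ a n ≤ 1)
    (hrec : ∀ n : ℕ, ((n : ℝ) + 1) * p (n + 1) = ∑ k ∈ Finset.range (n + 1), a k * p (n - k))
    (hs : Summable fun n : ℕ => a n / ((n : ℝ) + 1)) :
    HasSum p (Real.exp (∑' n : ℕ, a n / ((n : ℝ) + 1))) := by
  have hp' : ∀ n, |p n| ≤ 1 := fun n => by rw [abs_of_nonneg (hp n).1]; exact (hp n).2
  have ha' : ∀ n, |a n| ≤ 1 := fun n => by rw [abs_of_nonneg (ha n).1]; exact (ha n).2
  have hlim : Tendsto (fun z : ℝ => ∑' n, p n * z ^ n) (𝓝[<] 1)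
      (𝓝 (Real.exp (∑' n : ℕ, a n / ((n : ℝ) + 1)))) := by
    refine ((Real.continuous_exp.tendsto _).comp (tendsto_tsum_mul_pow_succ hs)).congr' ?_
    filter_upwards [eventually_abs_lt_one] with z hz
    exact (tsum_mul_pow_eq_exp hp0 hp' ha' hrec hz.2).symm
  have hsum : Summable p := by
    refine summable_of_sum_range_le (c := Real.exp (∑' n : ℕ, a n / ((n : ℝ) + 1)))
      (fun n => (hp n).1) fun n => ?_
    have h1 : Tendsto (fun z : ℝ => ∑ i ∈ Finset.range n, p i * z ^ i) (𝓝[<] 1)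
        (𝓝 (∑ i ∈ Finset.range n, p i * 1 ^ i)) :=
      ((by fun_prop : Continuous fun z : ℝ => ∑ i ∈ Finset.range n, p i * z ^ i).tendsto
        1).mono_left nhdsWithin_le_nhds
    simp only [one_pow, mul_one] at h1
    refine le_of_tendsto_of_tendsto h1 hlim ?_
    filter_upwards [eventually_abs_lt_one] with z hz
    exact (summable_mul_pow_of_abs_le_one hp' hz.2).of_norm.sum_le_tsum _
      fun i _ => mul_nonneg (hp i).1 (pow_nonneg hz.1.le i)
  have h2 := Real.tendsto_tsum_powerSeries_nhdsWithin_lt hsum.hasSum.tendsto_sum_nat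
  rw [tendsto_nhds_unique hlim h2]
  exact hsum.hasSum

/-- The case of positive drift. Multiplying the generating function by 1 - z = exp(-∑ z^(n+1)/(n+1))
replaces `a n` by `a n - 1` in the exponent, and turns the series of `p` into that of its increments
`d`, whose Abel limit is `l`. -/
theorem eq_exp_neg_of_recursion (hp0 : p 0 = 1) (hp : ∀ n, 0 ≤ p n ∧ p n ≤ 1)
    (ha : ∀ n, 0 ≤ a n ∧ a n ≤ 1)
    (hrec : ∀ n : ℕ, ((n : ℝ) + 1) * p (n + 1) = ∑ k ∈ Finset.range (n + 1), a k * p (n - k))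
    (hs : Summable fun n : ℕ => (1 - a n) / ((n : ℝ) + 1)) {l : ℝ} (hl : Tendsto p atTop (𝓝 l)) :
    l = Real.exp (-∑' n : ℕ, (1 - a n) / ((n : ℝ) + 1)) := by
  have hp' : ∀ n, |p n| ≤ 1 := fun n => by rw [abs_of_nonneg (hp n).1]; exact (hp n).2
  have ha' : ∀ n, |a n| ≤ 1 := fun n => by rw [abs_of_nonneg (ha n).1]; exact (ha n).2
  let d : ℕ → ℝ := fun n => if n = 0 then p 0 else p n - p (n - 1)
  have hd : ∀ n, ∑ i ∈ Finset.range (n + 1), d i = p n := by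
    intro n
    induction n with
    | zero => simp [d]
    | succ n ih => rw [Finset.sum_range_succ, ih]; simp [d]
  have hlim : Tendsto (fun z : ℝ => ∑' n, d n * z ^ n) (𝓝[<] 1) (𝓝 l) := by
    refine Real.tendsto_tsum_powerSeries_nhdsWithin_lt ?_
    rw [← tendsto_add_atTop_iff_nat 1]
    exact hl.congr fun n => (hd n).symm
  refine tendsto_nhds_unique hlim
    (((Real.continuous_exp.tendsto _).comp (tendsto_tsum_mul_pow_succ hs).neg).congr' ?_)
  filter_upwards [eventually_abs_lt_one] with z hz
  have hP := (summable_mul_pow_of_abs_le_one hp' hz.2).of_norm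
  have h1 : ∑' n, d n * z ^ n = (1 - z) * ∑' n, p n * z ^ n := by
    have hPs : Summable fun n => p (n + 1) * z ^ (n + 1) := (summable_nat_add_iff 1).2 hP
    have hPz : Summable fun n => z * (p n * z ^ n) := hP.mul_left z
    have hdn : ∀ n, d (n + 1) * z ^ (n + 1) = p (n + 1) * z ^ (n + 1) - z * (p n * z ^ n) := by
      intro n; simp only [d, Nat.succ_ne_zero, if_false, Nat.add_sub_cancel]; ring
    have hds : Summable fun n => d n * z ^ n := by
      rw [← summable_nat_add_iff 1]
      exact (hPs.sub hPz).congr fun n => (hdn n).symm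
    rw [hds.tsum_eq_zero_add, tsum_congr hdn, hPs.tsum_sub hPz, tsum_mul_left, hP.tsum_eq_zero_add]
    simp only [d, if_true]
    ring
  have hlog := Real.hasSum_pow_div_log_of_abs_lt_one hz.2
  have hA : Summable fun n : ℕ => a n / ((n : ℝ) + 1) * z ^ (n + 1) := by
    refine Summable.of_norm_bounded hlog.summable.norm fun n => ?_
    rw [norm_mul, norm_div, norm_div, Real.norm_eq_abs (a n)]
    rw [div_mul_eq_mul_div]
    gcongr
    exact mul_le_of_le_one_left (norm_nonneg _) (ha' n)
  have hz1 : z < 1 := (le_abs_self z).trans_lt hz.2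
  simp only [Function.comp_apply]
  rw [h1, tsum_mul_pow_eq_exp hp0 hp' ha' hrec hz.2]
  have h2 : -∑' n : ℕ, (1 - a n) / ((n : ℝ) + 1) * z ^ (n + 1) =
      Real.log (1 - z) + ∑' n : ℕ, a n / ((n : ℝ) + 1) * z ^ (n + 1) := by
    rw [← neg_neg (Real.log (1 - z)), ← hlog.tsum_eq]
    rw [neg_add_eq_sub, ← hA.tsum_sub hlog.summable, ← tsum_neg]
    refine tsum_congr fun n => ?_
    ring
  rw [h2, Real.exp_add, Real.exp_log (by linarith)]

end GeneratingFunction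

/-! ### The standard normal distribution function -/

section StandardNormal

theorem stdNormalCDF_eq (x : ℝ) : stdNormalCDF x = (gaussianReal 0 1).real (Set.Iic x) := by
  rw [stdNormalCDF, cdf_eq_real]

theorem stdNormalCDF_nonneg (x : ℝ) : 0 ≤ stdNormalCDF x := cdf_nonneg _ x

theorem stdNormalCDF_strictMono : StrictMono stdNormalCDF := by
  intro x y hxy
  have h1 : (gaussianReal 0 1).real (Set.Iic y) =
      (gaussianReal 0 1).real (Set.Iic x) + (gaussianReal 0 1).real (Set.Ioc x y) := by
    rw [← measureReal_union _ measurableSet_Ioc, Set.Iic_union_Ioc_eq_Iic hxy.le]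
    exact Set.disjoint_left.2 fun z hz hz' => not_lt.2 hz hz'.1
  have h2 : 0 < (gaussianReal 0 1).real (Set.Ioc x y) := by
    refine (measureReal_nonneg).lt_of_ne' fun h => ?_
    rw [measureReal_eq_zero_iff] at h
    have := gaussianReal_absolutelyContinuous' 0 one_ne_zero h
    simp [Real.volume_Ioc] at this
    linarith
  rw [stdNormalCDF_eq, stdNormalCDF_eq, h1]
  linarith

theorem stdNormalCDF_pos (x : ℝ) : 0 < stdNormalCDF x :=
  (stdNormalCDF_nonneg (x - 1)).trans_lt (stdNormalCDF_strictMono (by linarith))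

theorem stdNormalCDF_continuous : Continuous stdNormalCDF := by
  have := nullSingletonClass_gaussianReal (μ := 0) (v := 1) one_ne_zero
  refine continuous_iff_continuousAt.2 fun x => ?_
  have h1 : (cdf (gaussianReal 0 1)).measure {x} = 0 := by
    rw [measure_cdf]; exact measure_singleton x
  rw [StieltjesFunction.measure_singleton, ENNReal.ofReal_eq_zero] at h1
  have h2 := (monotone_cdf (gaussianReal 0 1)).leftLim_le (le_refl x)
  refine ((monotone_cdf (gaussianReal 0 1)).continuousAt_iff_leftLim_eq_rightLim).2 ?_
  rw [StieltjesFunction.rightLim_eq]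
  linarith

theorem stdNormalCDF_neg_le_exp {t : ℝ} (ht : 0 ≤ t) :
    stdNormalCDF (-t) ≤ Real.exp (-(t ^ 2 / 2)) := by
  rw [stdNormalCDF_eq]
  have h := measure_le_le_exp_mul_mgf (μ := gaussianReal 0 1) (X := id) (t := -t) (-t) (by linarith)
    (integrable_exp_mul_gaussianReal (-t))
  rw [mgf_id_gaussianReal] at h
  refine h.trans (le_of_eq ?_)
  simp only [NNReal.coe_one]
  rw [← Real.exp_add]
  congr 1
  ring

theorem gaussianReal_real_Ioi (y : ℝ) : (gaussianReal 0 1).real (Set.Ioi y) = stdNormalCDF (-y) := by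
  have := nullSingletonClass_gaussianReal (μ := 0) (v := 1) one_ne_zero
  have h := gaussianReal_map_neg (μ := 0) (v := 1)
  rw [neg_zero] at h
  rw [stdNormalCDF_eq, measureReal_def, measureReal_def]
  conv_rhs => rw [← h, Measure.map_apply measurable_neg measurableSet_Iic]
  congr 1
  have : (fun x : ℝ => -x) ⁻¹' Set.Iic (-y) = Set.Ici y := by ext; simp
  rw [this, measure_congr Ioi_ae_eq_Ici]

end StandardNormal

/-! ### Monotonicity, continuity and blow-up of C -/

section BoundaryC

theorem boundaryC_term_nonneg (x : ℝ) (n : ℕ) :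
    0 ≤ (1 / ((n : ℝ) + 1)) * stdNormalCDF (-(√((n : ℝ) + 1) * x)) :=
  mul_nonneg (by positivity) (stdNormalCDF_nonneg _)

/-- A Gaussian tail bound, geometric in `n` and uniform on `[x₀, ∞)`: it gives both convergence and
continuity. -/
theorem boundaryC_term_le {x₀ x : ℝ} (h0 : 0 < x₀) (hx : x₀ ≤ x) (n : ℕ) :
    (1 / ((n : ℝ) + 1)) * stdNormalCDF (-(√((n : ℝ) + 1) * x)) ≤ Real.exp (-(x₀ ^ 2 / 2)) ^ n := by
  have hx0 : 0 < x := h0.trans_le hx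
  have h1 := stdNormalCDF_neg_le_exp (t := √((n : ℝ) + 1) * x) (by positivity)
  rw [mul_pow, Real.sq_sqrt (by positivity)] at h1
  refine (mul_le_of_le_one_left (stdNormalCDF_nonneg _) ?_).trans (h1.trans ?_)
  · rw [div_le_one (by positivity)]; linarith [Nat.cast_nonneg (α := ℝ) n]
  · rw [← Real.exp_nat_mul, Real.exp_le_exp]
    have : x₀ ^ 2 ≤ x ^ 2 := by gcongr
    nlinarith [Nat.cast_nonneg (α := ℝ) n, sq_nonneg x]

theorem summable_boundaryC_bound {x₀ : ℝ} (h0 : 0 < x₀) :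
    Summable fun n : ℕ => Real.exp (-(x₀ ^ 2 / 2)) ^ n :=
  summable_geometric_of_lt_one (Real.exp_nonneg _) (Real.exp_lt_one_iff.2 (by nlinarith))

theorem summable_boundaryC {x : ℝ} (hx : 0 < x) :
    Summable fun n : ℕ => (1 / ((n : ℝ) + 1)) * stdNormalCDF (-(√((n : ℝ) + 1) * x)) :=
  Summable.of_nonneg_of_le (boundaryC_term_nonneg x) (boundaryC_term_le hx le_rfl)
    (summable_boundaryC_bound hx)

theorem boundaryC_pos (x : ℝ) : 0 < boundaryC x := Real.exp_pos _

theorem boundaryC_strictAntiOn : StrictAntiOn boundaryC (Set.Ioi 0) := by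
  intro x hx y hy hxy
  refine Real.exp_lt_exp.2 (Summable.tsum_lt_tsum (i := 0) (fun n => ?_) ?_
    (summable_boundaryC hy) (summable_boundaryC hx))
  · gcongr
    exact stdNormalCDF_strictMono.monotone (by gcongr)
  · gcongr
    exact stdNormalCDF_strictMono (by simpa using hxy)

theorem boundaryC_continuousOn : ContinuousOn boundaryC (Set.Ioi 0) := by
  intro x hx
  have hx : 0 < x := hx
  refine ContinuousAt.continuousWithinAt ?_
  have h : ContinuousOn (fun y : ℝ =>
      ∑' n : ℕ, (1 / ((n : ℝ) + 1)) * stdNormalCDF (-(√((n : ℝ) + 1) * y))) (Set.Ici (x / 2)) := by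
    refine continuousOn_tsum (fun n => ?_) (summable_boundaryC_bound (half_pos hx)) fun n y hy => ?_
    · have := stdNormalCDF_continuous
      fun_prop
    · rw [Real.norm_of_nonneg (boundaryC_term_nonneg y n)]
      exact boundaryC_term_le (half_pos hx) hy n
  exact Real.continuous_exp.continuousAt.comp (h.continuousAt (Ici_mem_nhds (by linarith)))

/-- For x at most 1/√(N+1) the first `N` terms are at least Φ(-1)/(n+1), and the harmonic series
diverges. This yields the critical level and also the recurrence of the driftless walk. -/
theorem exists_lt_boundaryC (K : ℝ) {y : ℝ} (hy : 0 < y) : ∃ x ∈ Set.Ioo 0 y, K < boundaryC x := by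
  have h1 : Tendsto (fun N : ℕ => Real.exp (stdNormalCDF (-1) *
      ∑ n ∈ Finset.range N, 1 / ((n : ℝ) + 1))) atTop atTop :=
    Real.tendsto_exp_atTop.comp (Real.tendsto_sum_range_one_div_nat_succ_atTop.const_mul_atTop
      (stdNormalCDF_pos _))
  obtain ⟨N, hN⟩ := (h1.eventually_gt_atTop K).exists
  have hs : 0 < √((N : ℝ) + 1) := by positivity
  refine ⟨min (y / 2) (1 / √((N : ℝ) + 1)), ⟨by positivity, by
    exact (min_le_left _ _).trans_lt (by linarith)⟩, hN.trans_le (Real.exp_le_exp.2 ?_)⟩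
  rw [Finset.mul_sum]
  refine le_trans (Finset.sum_le_sum fun n hn => ?_) ((summable_boundaryC (by positivity)).sum_le_tsum
    (Finset.range N) fun n _ => boundaryC_term_nonneg _ n)
  rw [mul_comm]
  gcongr
  refine stdNormalCDF_strictMono.monotone (neg_le_neg ?_)
  have hn' : (n : ℝ) ≤ N := by exact_mod_cast (Finset.mem_range.1 hn).le
  calc √((n : ℝ) + 1) * min (y / 2) (1 / √((N : ℝ) + 1))
      ≤ √((N : ℝ) + 1) * (1 / √((N : ℝ) + 1)) := by
        gcongr
        exact min_le_right _ _
    _ = 1 := by field_simp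

end BoundaryC

/-! ### Gaussian walks with drift -/

/-- The law of a sequence of independent standard normal variables. -/
noncomputable abbrev normalSeqLaw : Measure (ℕ → ℝ) := iidLaw (gaussianReal 0 1)

section NormalWalk

theorem iIndepFun_eval_normalSeqLaw : iIndepFun (fun (i : ℕ) (z : ℕ → ℝ) => z i) normalSeqLaw :=
  iIndepFun_infinitePi (P := fun _ : ℕ => gaussianReal 0 1) (X := fun _ y => y) fun _ =>
    measurable_id

theorem map_sum_normalSeqLaw (n : ℕ) :
    normalSeqLaw.map (fun z => ∑ j ∈ Finset.range n, z j) = gaussianReal 0 n := by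
  induction n with
  | zero => simp [gaussianReal_zero_var, Measure.map_const]
  | succ n ih =>
    have hind : IndepFun (fun z : ℕ → ℝ => ∑ j ∈ Finset.range n, z j) (fun z => z n)
        normalSeqLaw := by
      have := iIndepFun_eval_normalSeqLaw.indepFun_finsetSum_of_notMem
        (fun i => by fun_prop) (s := Finset.range n) (i := n) (by simp)
      convert! this using 1
      ext z; simp
    have h := gaussianReal_add_gaussianReal_of_indepFun hind ih
      (Measure.infinitePi_map_eval (fun _ : ℕ => gaussianReal 0 1) n)
    simp only [add_zero] at h
    push_cast
    rw [← h]
    congr 1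
    ext z; simp [Finset.sum_range_succ]

theorem normalSeqLaw_real_driftWalk_pos (x : ℝ) (n : ℕ) :
    normalSeqLaw.real {z | 0 < driftWalk x z (n + 1)} = stdNormalCDF (-(√((n : ℝ) + 1) * x)) := by
  have hs : 0 < √((n : ℝ) + 1) := by positivity
  have hsq : √((n : ℝ) + 1) * √((n : ℝ) + 1) = (n : ℝ) + 1 := Real.mul_self_sqrt (by positivity)
  have h1 : normalSeqLaw.map (fun z => (∑ j ∈ Finset.range (n + 1), z j) / √((n : ℝ) + 1)) =
      gaussianReal 0 1 := by
    have := congrArg (Measure.map fun y : ℝ => y / √((n : ℝ) + 1)) (map_sum_normalSeqLaw (n + 1))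
    rw [Measure.map_map (by fun_prop) (by fun_prop), gaussianReal_map_div_const] at this
    rw [Function.comp_def] at this
    rw [this]
    congr 1
    · simp
    · ext
      push_cast
      simp only [Real.sq_sqrt (show (0 : ℝ) ≤ (n : ℝ) + 1 by positivity)]
      field_simp
  rw [← gaussianReal_real_Ioi, ← h1, map_measureReal_apply (by fun_prop) measurableSet_Ioi]
  congr 1
  ext z
  simp only [driftWalk, Set.mem_ofPred_eq, Set.mem_preimage, Set.mem_Ioi, Finset.sum_sub_distrib,
    Finset.sum_const, Finset.card_range, nsmul_eq_mul]
  rw [lt_div_iff₀ hs]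
  push_cast
  rw [mul_right_comm, hsq, sub_pos]

theorem normalSeqLaw_real_driftWalk_nonpos (x : ℝ) (n : ℕ) :
    1 - normalSeqLaw.real {z | 0 < driftWalk x z (n + 1)} =
      stdNormalCDF (-(√((n : ℝ) + 1) * -x)) := by
  rw [normalSeqLaw_real_driftWalk_pos, ← gaussianReal_real_Ioi, stdNormalCDF_eq,
    ← Set.compl_Iic, probReal_compl_eq_one_sub measurableSet_Iic]
  rw [sub_sub_cancel, mul_neg, neg_neg]

theorem iidLaw_real_stayPos_zero (ρ : Measure ℝ) [IsProbabilityMeasure ρ] (x : ℝ) :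
    (iidLaw ρ).real (stayPos x 0) = 1 := by
  have : stayPos x 0 = Set.univ := by
    ext z; simp only [stayPos, Set.mem_ofPred_eq, Set.mem_univ, iff_true]; intro m h1 h2; omega
  rw [this, probReal_univ]

theorem hasSum_stayPos {x : ℝ} (hx : 0 < x) :
    HasSum (fun n => normalSeqLaw.real (stayPos x n)) (boundaryC x) := by
  have h := hasSum_exp_of_recursion (p := fun n => normalSeqLaw.real (stayPos x n))
    (a := fun n => normalSeqLaw.real {z | 0 < driftWalk x z (n + 1)})
    (iidLaw_real_stayPos_zero _ x) (fun n => ⟨measureReal_nonneg, measureReal_le_one⟩)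
    (fun n => ⟨measureReal_nonneg, measureReal_le_one⟩) (succ_mul_stayPos_succ _ x)
  simp only [normalSeqLaw_real_driftWalk_pos] at h
  have hrw : ∀ n : ℕ, stdNormalCDF (-(√((n : ℝ) + 1) * x)) / ((n : ℝ) + 1) =
      (1 / ((n : ℝ) + 1)) * stdNormalCDF (-(√((n : ℝ) + 1) * x)) := fun n => by ring
  simp only [hrw] at h
  exact h (summable_boundaryC hx)

theorem normalSeqLaw_real_iInter_stayPos {x : ℝ} (hx : 0 < x) :
    normalSeqLaw.real (⋂ n, stayPos (-x) n) = (boundaryC x)⁻¹ := by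
  have hanti : Antitone fun n => stayPos (-x) n := fun m n hmn z hz i h1 h2 => hz i h1 (h2.trans hmn)
  have hl : Tendsto (fun n => normalSeqLaw.real (stayPos (-x) n)) atTop
      (𝓝 (normalSeqLaw.real (⋂ n, stayPos (-x) n))) :=
    (ENNReal.tendsto_toReal (measure_ne_top _ _)).comp
      (tendsto_measure_iInter_atTop (fun n => (measurableSet_stayPos _ n).nullMeasurableSet) hanti
        ⟨0, measure_ne_top _ _⟩)
  have h := eq_exp_neg_of_recursion (p := fun n => normalSeqLaw.real (stayPos (-x) n))
    (a := fun n => normalSeqLaw.real {z | 0 < driftWalk (-x) z (n + 1)})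
    (iidLaw_real_stayPos_zero _ _) (fun n => ⟨measureReal_nonneg, measureReal_le_one⟩)
    (fun n => ⟨measureReal_nonneg, measureReal_le_one⟩) (succ_mul_stayPos_succ _ _) (hl := hl)
  simp only [normalSeqLaw_real_driftWalk_nonpos, neg_neg] at h
  have hrw : ∀ n : ℕ, stdNormalCDF (-(√((n : ℝ) + 1) * x)) / ((n : ℝ) + 1) =
      (1 / ((n : ℝ) + 1)) * stdNormalCDF (-(√((n : ℝ) + 1) * x)) := fun n => by ring
  simp only [hrw] at h
  rw [h (summable_boundaryC hx), Real.exp_neg]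
  rfl

end NormalWalk

/-! ### Running averages and last minima -/

section RunningAvg

theorem lt_runningAvg_iff {x : ℝ} {z : ℕ → ℝ} {n : ℕ} (hn : 1 ≤ n) :
    x < runningAvg z n ↔ 0 < driftWalk x z n := by
  have hn' : (0 : ℝ) < n := by exact_mod_cast hn
  rw [runningAvg, lt_div_iff₀ hn', driftWalk]
  simp only [Finset.sum_sub_distrib, Finset.sum_const, Finset.card_range, nsmul_eq_mul, sub_pos]
  rw [mul_comm]

theorem mem_stayPos_iff {x : ℝ} {z : ℕ → ℝ} {n : ℕ} :
    z ∈ stayPos x n ↔ ∀ m, 1 ≤ m → m ≤ n → x < runningAvg z m :=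
  forall₃_congr fun _ hm _ => (lt_runningAvg_iff hm).symm

theorem mem_iInter_stayPos_iff {x : ℝ} {z : ℕ → ℝ} :
    z ∈ ⋂ n, stayPos x n ↔ ∀ m, 1 ≤ m → x < runningAvg z m := by
  simp only [Set.mem_iInter, mem_stayPos_iff]
  exact ⟨fun h m hm => h m m hm le_rfl, fun h n m hm _ => h m hm⟩

theorem runningAvg_affine (m s : ℝ) (y : ℕ → ℝ) {n : ℕ} (hn : 1 ≤ n) :
    runningAvg (fun j => m + s * y j) n = m + s * runningAvg y n := by
  have hn' : (n : ℝ) ≠ 0 := by positivity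
  simp only [runningAvg, Finset.sum_add_distrib, Finset.sum_const, Finset.card_range, nsmul_eq_mul,
    ← Finset.mul_sum]
  field_simp

@[fun_prop]
theorem measurable_runningAvg (n : ℕ) : Measurable fun z => runningAvg z n := by
  unfold runningAvg; fun_prop

/-- A sequence that goes below its limit has a last minimum. -/
theorem exists_last_min {u : ℕ → ℝ} {l : ℝ} (hu : Tendsto u atTop (𝓝 l)) {m : ℕ} (hm : 1 ≤ m)
    (hml : u m < l) :
    ∃ n, 1 ≤ n ∧ (∀ i, 1 ≤ i → u n ≤ u i) ∧ ∀ i, n < i → u n < u i := by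
  -- Beyond `K` the sequence exceeds `u m`, so minimizers lie in a finite window and there is a last
  -- one.
  obtain ⟨K, hK⟩ := eventually_atTop.1 (hu.eventually_const_lt hml)
  let s := Finset.Icc 1 (max K m)
  have hms : m ∈ s := Finset.mem_Icc.2 ⟨hm, le_max_right _ _⟩
  obtain ⟨k, hks, hk⟩ := s.exists_min_image u ⟨m, hms⟩
  obtain ⟨n, hn, hmax⟩ := (s.filter fun i => u i = u k).exists_max_image id
    ⟨k, by simp [hks]⟩
  rw [Finset.mem_filter] at hn
  have hn1 : 1 ≤ n := (Finset.mem_Icc.1 hn.1).1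
  have hle : ∀ i, 1 ≤ i → u n ≤ u i := by
    intro i hi
    rw [hn.2]
    by_cases his : i ∈ s
    · exact hk i his
    · have : K ≤ i := by
        by_contra h
        exact his (Finset.mem_Icc.2 ⟨hi, by omega⟩)
      exact (hk m hms).trans (hK i this).le
  refine ⟨n, hn1, hle, fun i hi => (hle i (by omega)).lt_of_ne fun heq => ?_⟩
  by_cases his : i ∈ s
  · have := hmax i (Finset.mem_filter.2 ⟨his, by rw [← heq, hn.2]⟩)
    simp only [id] at this
    omega
  · have : K ≤ i := by
      by_contra h
      exact his (Finset.mem_Icc.2 ⟨by omega, by omega⟩)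
    have h1 := hK i this
    have h2 := hk m hms
    rw [← heq, hn.2] at h1
    exact absurd h1 (not_lt.2 h2)

end RunningAvg

/-! ### Almost sure path properties and first passage times -/

section NormalPaths

theorem ae_tendsto_runningAvg :
    ∀ᵐ z ∂normalSeqLaw, Tendsto (fun n => runningAvg z n) atTop (𝓝 0) := by
  have hmap : ∀ i, normalSeqLaw.map (fun z => z i) = gaussianReal 0 1 :=
    Measure.infinitePi_map_eval fun _ : ℕ => gaussianReal 0 1
  have hid : ∀ i, IdentDistrib (fun z : ℕ → ℝ => z i) (fun z => z 0) normalSeqLaw normalSeqLaw :=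
    fun i => ⟨(measurable_pi_apply i).aemeasurable, (measurable_pi_apply 0).aemeasurable,
      by rw [hmap, hmap]⟩
  have hint : Integrable (fun z : ℕ → ℝ => z 0) normalSeqLaw := by
    have h1 : Integrable (fun y : ℝ => y) (normalSeqLaw.map fun z => z 0) := by
      rw [hmap]; exact (memLp_id_gaussianReal 1).integrable (by simp)
    exact h1.comp_measurable (by fun_prop)
  have h := strong_law_ae_real (fun i (z : ℕ → ℝ) => z i) hint
    (fun i j hij => iIndepFun_eval_normalSeqLaw.indepFun hij) hid
  have hmean : ∫ z : ℕ → ℝ, z 0 ∂normalSeqLaw = 0 := by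
    rw [← integral_map (φ := fun z : ℕ → ℝ => z 0) (f := fun y => y)
      (measurable_pi_apply 0).aemeasurable (by fun_prop), hmap, integral_id_gaussianReal]
  rw [hmean] at h
  exact h

/-- Never going below 0 forces staying above -x for every x > 0, an event of probability 1/C(x),
which is arbitrarily small for x near 0. Averages that visit values below their limit 0 attain their
minimum. -/
theorem ae_exists_runningAvg_neg :
    ∀ᵐ z ∂normalSeqLaw, ∃ n, 1 ≤ n ∧ runningAvg z n < 0 := by
  have hle : ∀ x : ℝ, 0 < x →
      normalSeqLaw.real {z | ¬∃ n, 1 ≤ n ∧ runningAvg z n < 0} ≤ (boundaryC x)⁻¹ := by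
    intro x hx
    rw [← normalSeqLaw_real_iInter_stayPos hx]
    refine measureReal_mono fun z hz => mem_iInter_stayPos_iff.2 fun m hm => ?_
    rw [Set.mem_ofPred_eq] at hz
    push Not at hz
    linarith [hz m hm]
  rw [ae_iff, ← measureReal_eq_zero_iff]
  refine le_antisymm (le_of_forall_pos_le_add fun ε hε => ?_) measureReal_nonneg
  obtain ⟨x, hx, hK⟩ := exists_lt_boundaryC ε⁻¹ one_pos
  refine (hle x hx.1).trans ?_
  rw [zero_add]
  exact inv_le_of_inv_le₀ hε hK.le

/-- Excludes averages exactly at the critical level, for which no level strictly between would be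
available. -/
theorem ae_runningAvg_ne (y : ℝ) : ∀ᵐ z ∂normalSeqLaw, ∀ n, 1 ≤ n → runningAvg z n ≠ y := by
  rw [ae_all_iff]
  intro n
  by_cases hn : 1 ≤ n
  · have hn' : (n : ℝ) ≠ 0 := by positivity
    have hn'' : (n : NNReal) ≠ 0 := by positivity
    have := nullSingletonClass_gaussianReal (μ := 0) hn''
    have h1 : ∀ᵐ w ∂(normalSeqLaw.map fun z => ∑ j ∈ Finset.range n, z j), w ≠ y * n := by
      rw [map_sum_normalSeqLaw, ae_iff]
      simp
    filter_upwards [ae_of_ae_map (by fun_prop) h1] with z hz _ h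
    refine hz ?_
    rw [← h, runningAvg, div_mul_cancel₀ _ hn']
  · exact Eventually.of_forall fun z h => absurd h hn

/-- The first passage time of the running average to a level at most `x`. -/
noncomputable def passageTime (x : ℝ) (z : ℕ → ℝ) : ENNReal :=
  ∑' n, (stayPos x n).indicator 1 z

theorem measurable_passageTime (x : ℝ) : Measurable (passageTime x) := by
  refine Measurable.tsum fun n => ?_
  exact (measurable_one.indicator (measurableSet_stayPos x n))

theorem IsFirstPassage.passageTime_eq {x : ℝ} {z : ℕ → ℝ} {n : ℕ} (h : IsFirstPassage x z n) :
    passageTime x z = n := by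
  have hmem : ∀ m, z ∈ stayPos x m ↔ m < n := by
    intro m
    rw [mem_stayPos_iff]
    refine ⟨fun hm => ?_, fun hm i hi him => h.2.2 i hi (by omega)⟩
    by_contra hnm
    exact absurd (hm n h.1 (not_lt.1 hnm)) (not_lt.2 h.2.1)
  rw [passageTime, tsum_eq_sum (s := Finset.range n)]
  · rw [Finset.sum_congr rfl fun m hm => Set.indicator_of_mem
      ((hmem m).2 (Finset.mem_range.1 hm)) _]
    simp
  · intro m hm
    exact Set.indicator_of_notMem (fun h' => hm (Finset.mem_range.2 ((hmem m).1 h'))) _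

/-- Tail-sum formula for the mean; the term `n = 0`, an empty condition, counts the first
observation. -/
theorem lintegral_passageTime {x : ℝ} (hx : 0 < x) :
    ∫⁻ z, passageTime x z ∂normalSeqLaw = ENNReal.ofReal (boundaryC x) := by
  have h := hasSum_stayPos hx
  simp only [passageTime]
  rw [lintegral_tsum fun n =>
    (measurable_one.indicator (measurableSet_stayPos x n)).aemeasurable]
  simp_rw [lintegral_indicator_one (measurableSet_stayPos x _)]
  rw [← h.tsum_eq, ENNReal.ofReal_tsum_of_nonneg (fun n => measureReal_nonneg) h.summable]
  exact tsum_congr fun n => (ofReal_measureReal (measure_ne_top _ _)).symm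

theorem ae_passageTime_lt_top {x : ℝ} (hx : 0 < x) : ∀ᵐ z ∂normalSeqLaw, passageTime x z < ⊤ :=
  ae_lt_top (measurable_passageTime x) (by rw [lintegral_passageTime hx]; exact ENNReal.ofReal_ne_top)

theorem exists_isFirstPassage {x : ℝ} {z : ℕ → ℝ} (h : ∃ n, 1 ≤ n ∧ runningAvg z n ≤ x) :
    ∃ n, IsFirstPassage x z n := by
  classical
  refine ⟨Nat.find h, (Nat.find_spec h).1, (Nat.find_spec h).2, fun m hm hmn => ?_⟩
  have := Nat.find_min h hmn
  push Not at this
  exact this hm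

theorem ae_exists_isFirstPassage {x : ℝ} (hx : 0 < x) :
    ∀ᵐ z ∂normalSeqLaw, ∃ n, IsFirstPassage x z n := by
  filter_upwards [ae_passageTime_lt_top hx] with z hz
  refine exists_isFirstPassage ?_
  by_contra! hcon
  refine hz.ne ?_
  have : ∀ n, (stayPos x n).indicator (1 : (ℕ → ℝ) → ENNReal) z = 1 := fun n =>
    Set.indicator_of_mem (mem_stayPos_iff.2 fun m hm _ => hcon m hm) _
  simp only [passageTime, this]
  exact ENNReal.tsum_const_eq_top_of_ne_zero one_ne_zero

theorem integrable_passageTime {x : ℝ} (hx : 0 < x) :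
    Integrable (fun z => (passageTime x z).toReal) normalSeqLaw :=
  integrable_toReal_of_lintegral_ne_top (measurable_passageTime x).aemeasurable
    (by rw [lintegral_passageTime hx]; exact ENNReal.ofReal_ne_top)

theorem integral_passageTime {x : ℝ} (hx : 0 < x) :
    ∫ z, (passageTime x z).toReal ∂normalSeqLaw = boundaryC x := by
  rw [integral_toReal (measurable_passageTime x).aemeasurable (ae_passageTime_lt_top hx),
    lintegral_passageTime hx, ENNReal.toReal_ofReal (boundaryC_pos x).le]

end NormalPaths

/-! ### Law of large numbers for passage times -/

section NormalArray

/-- The law of an infinite array of independent standard normal variables. -/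
noncomputable abbrev normalArrayLaw (ι : Type*) : Measure (ι → ℕ → ℝ) :=
  Measure.infinitePi fun _ : ι => normalSeqLaw

theorem ae_normalArrayLaw_eval {ι : Type*} (i : ι) {p : (ℕ → ℝ) → Prop}
    (h : ∀ᵐ z ∂normalSeqLaw, p z) : ∀ᵐ z ∂normalArrayLaw ι, p (z i) := by
  have hm := Measure.infinitePi_map_eval (fun _ : ι => normalSeqLaw) i
  rw [← hm] at h
  exact ae_of_ae_map (measurable_pi_apply i).aemeasurable h

theorem ae_tendsto_avg_passageTime {x : ℝ} (hx : 0 < x) :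
    ∀ᵐ z ∂normalArrayLaw ℕ, Tendsto (fun k : ℕ =>
      (∑ i ∈ Finset.range k, (passageTime x (z (i + 1))).toReal) / k) atTop (𝓝 (boundaryC x)) := by
  have hmap : ∀ i, (normalArrayLaw ℕ).map (fun z => z i) = normalSeqLaw :=
    Measure.infinitePi_map_eval fun _ : ℕ => normalSeqLaw
  have hmeas : Measurable fun z => (passageTime x z).toReal :=
    (measurable_passageTime x).ennreal_toReal
  have hmap' : ∀ i, (normalArrayLaw ℕ).map (fun z => (passageTime x (z i)).toReal) =
      normalSeqLaw.map (fun z => (passageTime x z).toReal) := by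
    intro i
    conv_rhs => rw [← hmap i]
    rw [Measure.map_map hmeas (by fun_prop)]
    rfl
  have hid : ∀ i, IdentDistrib (fun z : ℕ → ℕ → ℝ => (passageTime x (z (i + 1))).toReal)
      (fun z => (passageTime x (z (0 + 1))).toReal) (normalArrayLaw ℕ) (normalArrayLaw ℕ) :=
    fun i => ⟨(hmeas.comp (measurable_pi_apply _)).aemeasurable,
      (hmeas.comp (measurable_pi_apply _)).aemeasurable, by rw [hmap', hmap']⟩
  have hind : iIndepFun (fun (i : ℕ) (z : ℕ → ℕ → ℝ) => (passageTime x (z i)).toReal)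
      (normalArrayLaw ℕ) :=
    iIndepFun_infinitePi (P := fun _ : ℕ => normalSeqLaw)
      (X := fun _ z => (passageTime x z).toReal) fun _ => hmeas
  have hint : Integrable (fun z : ℕ → ℕ → ℝ => (passageTime x (z (0 + 1))).toReal)
      (normalArrayLaw ℕ) := by
    have h1 := integrable_passageTime hx
    rw [← hmap (0 + 1)] at h1
    exact h1.comp_measurable (by fun_prop)
  have h := strong_law_ae_real (fun i (z : ℕ → ℕ → ℝ) => (passageTime x (z (i + 1))).toReal) hint
    (fun i j hij => hind.indepFun (by simpa using hij)) hid
  have hmean : ∫ z : ℕ → ℕ → ℝ, (passageTime x (z (0 + 1))).toReal ∂normalArrayLaw ℕ =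
      boundaryC x := by
    rw [← integral_passageTime hx, ← hmap (0 + 1), integral_map
      (measurable_pi_apply _).aemeasurable hmeas.aestronglyMeasurable]
  rw [hmean] at h
  exact h

end NormalArray

/-! ### Measurable events that decide the selection -/

section SelectionEvents

/-- An event, in terms of the standardized observations, on which the greedy procedure selects
alternative `0`. -/
def selectEvent (r : ℝ) (k B : ℕ) : Set (Fin (k + 1) → ℕ → ℝ) :=
  {y | ∃ (q : ℚ) (n : ℕ) (N : Fin (k + 1) → ℕ), 1 ≤ n ∧
    (∀ m, 1 ≤ m → (q : ℝ) - r < runningAvg (y 0) m) ∧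
    (∀ m, n < m → runningAvg (y 0) n < runningAvg (y 0) m) ∧
    (∀ i, i ≠ 0 → IsFirstPassage q (y i) (N i)) ∧
    ∑ i ∈ Finset.univ.erase 0, N i + n < B}

/-- An event, in terms of the standardized observations, on which the greedy procedure does not
select alternative `0`. -/
def rejectEvent (r : ℝ) (k B : ℕ) : Set (Fin (k + 1) → ℕ → ℝ) :=
  {y | ∃ (q w : ℚ) (n : ℕ) (N M : Fin (k + 1) → ℕ), 1 ≤ n ∧
    runningAvg (y 0) n ≤ (q : ℝ) - r ∧
    (∀ m, 1 ≤ m → m < n → (w : ℝ) - r < runningAvg (y 0) m) ∧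
    (∀ i, i ≠ 0 → IsFirstPassage q (y i) (N i)) ∧
    (∀ i, i ≠ 0 → IsFirstPassage w (y i) (M i)) ∧
    B ≤ ∑ i ∈ Finset.univ.erase 0, N i ∧
    ∑ i ∈ Finset.univ.erase 0, M i + n ≤ B}

theorem measurable_isFirstPassage {ι : Type*} (x : ℝ) (i : ι) (n : ℕ) :
    Measurable fun y : ι → ℕ → ℝ => IsFirstPassage x (y i) n := by
  have h : ∀ m, Measurable fun y : ι → ℕ → ℝ => runningAvg (y i) m := fun m =>
    (measurable_runningAvg m).comp (measurable_pi_apply i)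
  unfold IsFirstPassage
  exact measurable_const.and ((measurableSet_setOfPred.1 (measurableSet_le (h n) measurable_const)).and
    (Measurable.forall fun m => measurable_const.imp (measurable_const.imp
      (measurableSet_setOfPred.1 (measurableSet_lt measurable_const (h m))))))

/-- Every quantifier ranges over a countable type, which is why levels are rational. The event does
not mention the tie-breaking rule, which may be nonmeasurable. -/
theorem measurableSet_selectEvent (r : ℝ) (k B : ℕ) : MeasurableSet (selectEvent r k B) := by
  have h : ∀ m, Measurable fun y : Fin (k + 1) → ℕ → ℝ => runningAvg (y 0) m := fun m =>
    (measurable_runningAvg m).comp (measurable_pi_apply 0)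
  refine measurableSet_setOfPred.2 (Measurable.exists fun q => Measurable.exists fun n =>
    Measurable.exists fun N => measurable_const.and (Measurable.and ?_ (Measurable.and ?_
      (Measurable.and ?_ measurable_const))))
  · exact Measurable.forall fun m => measurable_const.imp
      (measurableSet_setOfPred.1 (measurableSet_lt measurable_const (h m)))
  · exact Measurable.forall fun m => measurable_const.imp
      (measurableSet_setOfPred.1 (measurableSet_lt (h n) (h m)))
  · exact Measurable.forall fun i => measurable_const.imp (measurable_isFirstPassage _ _ _)

theorem measurableSet_rejectEvent (r : ℝ) (k B : ℕ) : MeasurableSet (rejectEvent r k B) := by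
  have h : ∀ m, Measurable fun y : Fin (k + 1) → ℕ → ℝ => runningAvg (y 0) m := fun m =>
    (measurable_runningAvg m).comp (measurable_pi_apply 0)
  refine measurableSet_setOfPred.2 (Measurable.exists fun q => Measurable.exists fun w =>
    Measurable.exists fun n => Measurable.exists fun N => Measurable.exists fun M =>
    measurable_const.and (Measurable.and ?_ (Measurable.and ?_ (Measurable.and ?_
      (Measurable.and ?_ measurable_const)))))
  · exact measurableSet_setOfPred.1 (measurableSet_le (h n) measurable_const)
  · exact Measurable.forall fun m => measurable_const.imp (measurable_const.imp
      (measurableSet_setOfPred.1 (measurableSet_lt measurable_const (h m))))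
  · exact Measurable.forall fun i => measurable_const.imp (measurable_isFirstPassage _ _ _)
  · exact Measurable.forall fun i => measurable_const.imp (measurable_isFirstPassage _ _ _)

theorem IsFirstPassage.affine {x m s : ℝ} (hs : 0 < s) {y : ℕ → ℝ} {n : ℕ}
    (h : IsFirstPassage x y n) : IsFirstPassage (m + s * x) (fun j => m + s * y j) n := by
  refine ⟨h.1, ?_, fun i hi hin => ?_⟩
  · rw [runningAvg_affine m s y h.1]
    have := h.2.1
    gcongr
  · rw [runningAvg_affine m s y hi]
    have := h.2.2 i hi hin
    gcongr

variable {k B : ℕ} {a : (Fin (k + 1) → ℝ) → Fin (k + 1)} {m : Fin (k + 1) → ℝ} {γ σ : ℝ}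
  {y : Fin (k + 1) → ℕ → ℝ}

theorem greedySelection_eq_of_mem (ha : IsArgmaxRule a) (hσ : 0 < σ)
    (hm : ∀ i, i ≠ 0 → m 0 - m i = γ) (hB : k + 1 ≤ B) (hy : y ∈ selectEvent (γ / σ) k B) :
    greedySelection a (fun i j => m i + σ * y i j) B = 0 := by
  obtain ⟨q, n, N, hn, h1, h2, h3, h4⟩ := hy
  -- This level is `m i + σ * q` for each inferior `i`; for alternative `0` it is `q - γ / σ` in
  -- standardized units.
  refine greedySelection_eq ha (b := m 0 - γ + σ * q) hn (by simpa using hB) (fun i hi => ?_)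
    (fun i hi => ?_) (N := N) (fun i hi => ?_) h4
  · rw [runningAvg_affine _ _ _ hi]
    have := mul_lt_mul_of_pos_left (h1 i hi) hσ
    rw [mul_sub, mul_div_cancel₀ _ hσ.ne'] at this
    linarith
  · rw [runningAvg_affine _ _ _ hn, runningAvg_affine _ _ _ (by omega)]
    have := h2 i hi
    gcongr
  · have h5 := (h3 i hi).affine (m := m i) hσ
    rw [show m 0 - γ = m i by linarith [hm i hi]]
    exact ⟨h5.1, h5.2.1⟩

theorem greedySelection_ne_of_mem (ha : IsArgmaxRule a) (hσ : 0 < σ)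
    (hm : ∀ i, i ≠ 0 → m 0 - m i = γ) (hB : k + 1 ≤ B) (hy : y ∈ rejectEvent (γ / σ) k B) :
    greedySelection a (fun i j => m i + σ * y i j) B ≠ 0 := by
  obtain ⟨q, w, n, N, M, hn, h1, h2, h3, h4, h5, h6⟩ := hy
  refine greedySelection_ne ha (b := m 0 - γ + σ * q) (w := m 0 - γ + σ * w) hn (by simpa using hB)
    ?_ (fun i hi hin => ?_) (N := N) (M := M) (fun i hi => ?_) (fun i hi => ?_) h5 h6
  · rw [runningAvg_affine _ _ _ hn]
    have := mul_le_mul_of_nonneg_left h1 hσ.le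
    rw [mul_sub, mul_div_cancel₀ _ hσ.ne'] at this
    linarith
  · rw [runningAvg_affine _ _ _ hi]
    have := mul_lt_mul_of_pos_left (h2 i hi hin) hσ
    rw [mul_sub, mul_div_cancel₀ _ hσ.ne'] at this
    linarith
  · rw [show m 0 - γ = m i by linarith [hm i hi]]
    exact (h3 i hi).affine hσ
  · have h7 := (h4 i hi).affine (m := m i) hσ
    rw [show m 0 - γ = m i by linarith [hm i hi]]
    exact ⟨h7.1, h7.2.1⟩

end SelectionEvents

/-! ### Which event occurs for large k -/

section Asymptotics

theorem eventually_add_lt_budget {c d : ℝ} {B : ℕ → ℕ}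
    (hB : ∀ k : ℕ, |(B k : ℝ) - c * ((k : ℝ) + 1)| < 1) (hd : d < c) (e : ℝ) :
    ∀ᶠ k : ℕ in atTop, d * k + e < B k := by
  have h : Tendsto (fun k : ℕ => (c - d) * (k : ℝ)) atTop atTop :=
    tendsto_natCast_atTop_atTop.const_mul_atTop (sub_pos.2 hd)
  filter_upwards [h.eventually_gt_atTop (e + 1 - c)] with k hk
  have := (abs_lt.1 (hB k)).1
  linarith

theorem eventually_budget_lt {c d : ℝ} {B : ℕ → ℕ}
    (hB : ∀ k : ℕ, |(B k : ℝ) - c * ((k : ℝ) + 1)| < 1) (hd : c < d) :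
    ∀ᶠ k : ℕ in atTop, (B k : ℝ) < d * k := by
  have h : Tendsto (fun k : ℕ => (d - c) * (k : ℝ)) atTop atTop :=
    tendsto_natCast_atTop_atTop.const_mul_atTop (sub_pos.2 hd)
  filter_upwards [h.eventually_gt_atTop (c + 1)] with k hk
  have := (abs_lt.1 (hB k)).2
  linarith

/-- The sum of the first passage times of the rows `1, …, k` of an array, in terms of `passageTime`. -/
theorem sum_erase_zero_eq {x : ℝ} {z : ℕ → ℕ → ℝ} {N : ℕ → ℕ}
    (hN : ∀ i, IsFirstPassage x (z i) (N i)) (k : ℕ) :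
    ((∑ i ∈ Finset.univ.erase (0 : Fin (k + 1)), N i : ℕ) : ℝ) =
      ∑ i ∈ Finset.range k, (passageTime x (z (i + 1))).toReal := by
  have h1 : ∑ i ∈ Finset.univ.erase (0 : Fin (k + 1)), N i = ∑ i ∈ Finset.range k, N (i + 1) := by
    have h2 := Fin.sum_univ_succ fun i : Fin (k + 1) => N i
    rw [← Finset.add_sum_erase _ _ (Finset.mem_univ 0)] at h2
    rw [Finset.sum_range fun i => N (i + 1)]
    simpa using h2
  rw [h1]
  push_cast
  refine Finset.sum_congr rfl fun i _ => ?_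
  rw [(hN (i + 1)).passageTime_eq]
  simp

variable {x r c : ℝ} {B : ℕ → ℕ} {z : ℕ → ℕ → ℝ}

theorem eventually_sum_add_lt_budget {N : ℕ → ℕ} (hN : ∀ i, IsFirstPassage x (z i) (N i))
    (hlim : Tendsto (fun k : ℕ =>
      (∑ i ∈ Finset.range k, (passageTime x (z (i + 1))).toReal) / k) atTop (𝓝 (boundaryC x)))
    (hB : ∀ k : ℕ, |(B k : ℝ) - c * ((k : ℝ) + 1)| < 1) (hc : boundaryC x < c) (n : ℕ) :
    ∀ᶠ k : ℕ in atTop, ∑ i ∈ Finset.univ.erase (0 : Fin (k + 1)), N i + n < B k := by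
  obtain ⟨d, hd1, hd2⟩ := exists_between hc
  filter_upwards [hlim.eventually_lt_const hd1, eventually_add_lt_budget hB hd2 n,
    eventually_gt_atTop 0] with k h1 h2 hk
  have hk' : (0 : ℝ) < k := by exact_mod_cast hk
  rw [div_lt_iff₀ hk', ← sum_erase_zero_eq hN] at h1
  exact_mod_cast (by linarith : ((∑ i ∈ Finset.univ.erase (0 : Fin (k + 1)), N i : ℕ) : ℝ) + n < B k)

theorem eventually_budget_le_sum {N : ℕ → ℕ} (hN : ∀ i, IsFirstPassage x (z i) (N i))
    (hlim : Tendsto (fun k : ℕ =>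
      (∑ i ∈ Finset.range k, (passageTime x (z (i + 1))).toReal) / k) atTop (𝓝 (boundaryC x)))
    (hB : ∀ k : ℕ, |(B k : ℝ) - c * ((k : ℝ) + 1)| < 1) (hc : c < boundaryC x) :
    ∀ᶠ k : ℕ in atTop, B k ≤ ∑ i ∈ Finset.univ.erase (0 : Fin (k + 1)), N i := by
  obtain ⟨d, hd1, hd2⟩ := exists_between hc
  filter_upwards [hlim.eventually_const_lt hd2, eventually_budget_lt hB hd1,
    eventually_gt_atTop 0] with k h1 h2 hk
  have hk' : (0 : ℝ) < k := by exact_mod_cast hk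
  rw [lt_div_iff₀ hk', ← sum_erase_zero_eq hN] at h1
  exact_mod_cast (h2.trans h1).le

/-- A rational `q` fits strictly between `x` and the minimum shifted by `r`; as C strictly
decreases, C(q) < c, which leaves room for the `n` observations up to the last minimum. -/
theorem eventually_mem_selectEvent (hx : 0 < x) (hxc : boundaryC x = c)
    (hB : ∀ k : ℕ, |(B k : ℝ) - c * ((k : ℝ) + 1)| < 1)
    (hlim : ∀ q : ℚ, 0 < q → Tendsto (fun k : ℕ =>
      (∑ i ∈ Finset.range k, (passageTime q (z (i + 1))).toReal) / k) atTop (𝓝 (boundaryC q)))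
    (hpass : ∀ q : ℚ, 0 < q → ∀ i, ∃ n, IsFirstPassage q (z i) n)
    {n : ℕ} (hn : 1 ≤ n) (hmin : ∀ m, 1 ≤ m → runningAvg (z 0) n ≤ runningAvg (z 0) m)
    (hmin' : ∀ m, n < m → runningAvg (z 0) n < runningAvg (z 0) m)
    (habove : x - r < runningAvg (z 0) n) :
    ∀ᶠ k : ℕ in atTop, (fun i : Fin (k + 1) => z i) ∈ selectEvent r k (B k) := by
  obtain ⟨q, hq1, hq2⟩ := exists_rat_btwn (show x < runningAvg (z 0) n + r by linarith)
  have hq0 : (0 : ℝ) < q := hx.trans hq1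
  have hq0' : 0 < q := by exact_mod_cast hq0
  choose N hN using hpass q hq0'
  have hC : boundaryC q < c := by
    rw [← hxc]; exact boundaryC_strictAntiOn hx hq0 hq1
  filter_upwards [eventually_sum_add_lt_budget hN (hlim q hq0') hB hC n] with k hk
  exact ⟨q, n, fun i => N i, hn, fun m hm => by simpa using (by linarith [hmin m hm]), by simpa using hmin',
    fun i _ => hN i, hk⟩

theorem eventually_mem_rejectEvent (hx : 0 < x) (hxc : boundaryC x = c)
    (hB : ∀ k : ℕ, |(B k : ℝ) - c * ((k : ℝ) + 1)| < 1)
    (hlim : ∀ q : ℚ, 0 < q → Tendsto (fun k : ℕ =>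
      (∑ i ∈ Finset.range k, (passageTime q (z (i + 1))).toReal) / k) atTop (𝓝 (boundaryC q)))
    (hpass : ∀ q : ℚ, 0 < q → ∀ i, ∃ n, IsFirstPassage q (z i) n)
    (hne : ∀ m, 1 ≤ m → runningAvg (z 0) m ≠ x - r)
    (hbelow : ∃ m, 1 ≤ m ∧ runningAvg (z 0) m ≤ x - r) :
    ∀ᶠ k : ℕ in atTop, (fun i : Fin (k + 1) => z i) ∈ rejectEvent r k (B k) := by
  obtain ⟨n, hn, hnx, hfirst⟩ := exists_isFirstPassage hbelow
  have hnx' : runningAvg (z 0) n < x - r := lt_of_le_of_ne hnx (hne n hn)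
  -- The `max 0` keeps `q` positive, where C is strictly decreasing and the passage time has finite
  -- mean.
  obtain ⟨q, hq1, hq2⟩ := exists_rat_btwn
    (show max 0 (runningAvg (z 0) n + r) < x from max_lt hx (by linarith))
  have hq0 : (0 : ℝ) < q := (le_max_left _ _).trans_lt hq1
  have hq0' : 0 < q := by exact_mod_cast hq0
  -- Finitely many averages precede the passage and all exceed `x - r`, so they still exceed `w - r`
  -- for `w` slightly above `x`.
  have hw : ∀ᶠ w in 𝓝[>] x, ∀ m ∈ Finset.range n, 1 ≤ m → w - r < runningAvg (z 0) m := by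
    rw [Filter.eventually_all_finset]
    intro m hm
    by_cases h1 : 1 ≤ m
    · have h2 := hfirst m h1 (Finset.mem_range.1 hm)
      filter_upwards [Ioo_mem_nhdsGT (show x < runningAvg (z 0) m + r by linarith)] with w hw _
      linarith [hw.2]
    · exact Eventually.of_forall fun _ h => absurd h h1
  obtain ⟨u, hu1, hu2⟩ := (hw.and self_mem_nhdsWithin).exists
  obtain ⟨w, hw1, hw2⟩ := exists_rat_btwn (show x < u from hu2)
  have hw0 : (0 : ℝ) < w := hx.trans hw1
  have hw0' : 0 < w := by exact_mod_cast hw0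
  choose N hN using hpass q hq0'
  choose M hM using hpass w hw0'
  have hCq : c < boundaryC q := by
    rw [← hxc]; exact boundaryC_strictAntiOn hq0 hx hq2
  have hCw : boundaryC w < c := by
    rw [← hxc]; exact boundaryC_strictAntiOn hx hw0 hw1
  filter_upwards [eventually_budget_le_sum hN (hlim q hq0') hB hCq,
    eventually_sum_add_lt_budget hM (hlim w hw0') hB hCw n] with k hk1 hk2
  refine ⟨q, w, n, fun i => N i, fun i => M i, hn, ?_, fun m hm hmn => ?_, fun i _ => hN i,
    fun i _ => hM i, hk1, hk2.le⟩
  · have := (le_max_right 0 (runningAvg (z 0) n + r)).trans_lt hq1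
    simp only [Fin.val_zero]; linarith
  · have := hu1 m (Finset.mem_range.2 hmn) hm
    simp only [Fin.val_zero]; linarith

/-- If almost every point of `A` eventually belongs to `G k`, the measure of `G k ∩ A` tends to
that of `A`. -/
theorem tendsto_measureReal_inter_of_ae_eventually {α : Type*} [MeasurableSpace α] (Q : Measure α)
    [IsFiniteMeasure Q] {A : Set α} (hA : MeasurableSet A) {G : ℕ → Set α}
    (hG : ∀ k, MeasurableSet (G k)) (h : ∀ᵐ z ∂Q, z ∈ A → ∀ᶠ k in atTop, z ∈ G k) :
    Tendsto (fun k => Q.real (G k ∩ A)) atTop (𝓝 (Q.real A)) := by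
  refine (ENNReal.tendsto_toReal (measure_ne_top Q A)).comp ?_
  refine tendsto_measure_of_ae_tendsto_indicator atTop hA (fun k => (hG k).inter hA) (B := Set.univ)
    MeasurableSet.univ (measure_ne_top _ _) (Eventually.of_forall fun _ => Set.subset_univ _) ?_
  filter_upwards [h] with z hz
  by_cases hzA : z ∈ A
  · filter_upwards [hz hzA] with k hk
    simp [hk, hzA]
  · exact Eventually.of_forall fun k => by simp [hzA]

end Asymptotics

/-! ### Passing to standardized arrays -/

section Transfer

theorem normalArrayLaw_map_fin (k : ℕ) :
    (normalArrayLaw ℕ).map (fun z (i : Fin (k + 1)) => z i) = normalArrayLaw (Fin (k + 1)) :=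
  Measure.map_infinitePi_infinitePi_of_inj (P := fun _ : ℕ => normalSeqLaw) Fin.val_injective

variable {Ω : Type*} [MeasurableSpace Ω] {P : Measure Ω}

/-- The standardized observations form an array of independent standard normal variables. -/
theorem hasLaw_standardized {ι : Type*} [Countable ι] {X : ι → ℕ → Ω → ℝ} {μ : ι → ℝ} {σ : ℝ}
    (hσ : 0 < σ) (hlaw : ∀ i j, HasLaw (X i j) (gaussianReal (μ i) (σ ^ 2).toNNReal) P)
    (hindep : iIndepFun (fun p : ι × ℕ => X p.1 p.2) P) :
    HasLaw (fun ω i j => (X i j ω - μ i) / σ) (normalArrayLaw ι) P := by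
  have hstd : ∀ p : ι × ℕ, HasLaw (fun ω => (X p.1 p.2 ω - μ p.1) / σ) (gaussianReal 0 1) P := by
    intro p
    have h := gaussianReal_div_const (gaussianReal_sub_const (hlaw p.1 p.2) (μ p.1)) σ
    convert! h using 2
    · simp
    · ext
      simp only [NNReal.coe_one, NNReal.coe_div, Real.coe_toNNReal _ (sq_nonneg σ), NNReal.coe_mk]
      field_simp
  have hindep' : iIndepFun (fun (p : ι × ℕ) ω => (X p.1 p.2 ω - μ p.1) / σ) P :=
    hindep.comp (fun p y => (y - μ p.1) / σ) fun p => by fun_prop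
  have hmeas : AEMeasurable (fun ω (p : ι × ℕ) => (X p.1 p.2 ω - μ p.1) / σ) P :=
    aemeasurable_pi_iff.2 fun p => (hstd p).aemeasurable
  have h := hindep'.hasLaw_infinitePi hstd hmeas
  have hcurry : Measurable (MeasurableEquiv.curry ι ℕ ℝ) := MeasurableEquiv.measurable _
  refine ⟨hcurry.comp_aemeasurable hmeas, ?_⟩
  have h2 := Measure.infinitePi_map_curry (fun (_ : ι) (_ : ℕ) => gaussianReal 0 1)
  rw [← h.map_eq, AEMeasurable.map_map_of_aemeasurable hcurry.aemeasurable hmeas] at h2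
  exact h2

theorem measureReal_preimage_of_hasLaw {α β : Type*} [MeasurableSpace α] [MeasurableSpace β]
    {Q : Measure α} {R : Measure β} {f : α → β} (hf : HasLaw f R Q) {A : Set β}
    (hA : MeasurableSet A) : Q.real (f ⁻¹' A) = R.real A := by
  rw [measureReal_def, measureReal_def, ← hf.map_eq, Measure.map_apply_of_aemeasurable
    hf.aemeasurable hA]

end Transfer

/-! ### The law of the minimum of the running averages -/

section MinAbove

theorem ae_exists_isLeast_runningAvg_iff (δ : ℝ) :
    ∀ᵐ z ∂normalSeqLaw, (∃ n, 1 ≤ n ∧ (∀ i, 1 ≤ i → runningAvg z n ≤ runningAvg z i) ∧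
      -δ < runningAvg z n) ↔ z ∈ ⋂ n, stayPos (-δ) n := by
  filter_upwards [ae_tendsto_runningAvg, ae_exists_runningAvg_neg] with z hz ⟨m, hm, hm0⟩
  rw [mem_iInter_stayPos_iff]
  constructor
  · rintro ⟨n, hn, hmin, hlt⟩ i hi
    exact hlt.trans_le (hmin i hi)
  · intro h
    obtain ⟨n, hn, hmin, -⟩ := exists_last_min hz hm hm0
    exact ⟨n, hn, hmin, h n hn⟩

theorem probMinAbove_eq {Ω : Type*} [MeasurableSpace Ω] {P : Measure Ω} {Y : ℕ → Ω → ℝ}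
    {m σ γ₀ : ℝ} (hσ : 0 < σ) (hγ₀ : 0 < γ₀)
    (hlaw : HasLaw (fun ω j => (Y j ω - m) / σ) normalSeqLaw P) :
    probMinAbove P Y (m - γ₀) = (boundaryC (γ₀ / σ))⁻¹ := by
  have hδ : 0 < γ₀ / σ := div_pos hγ₀ hσ
  have hmeas : MeasurableSet (⋂ n, stayPos (-(γ₀ / σ)) n) :=
    .iInter fun n => measurableSet_stayPos _ n
  rw [← normalSeqLaw_real_iInter_stayPos hδ, ← measureReal_preimage_of_hasLaw hlaw hmeas, probMinAbove]
  refine measureReal_congr ?_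
  have hae := ae_exists_isLeast_runningAvg_iff (γ₀ / σ)
  rw [← hlaw.map_eq] at hae
  filter_upwards [ae_of_ae_map hlaw.aemeasurable hae] with ω hω
  refine propext (Iff.trans ?_ hω)
  set y : ℕ → ℝ := fun j => (Y j ω - m) / σ with hy
  have hY : (fun j => Y j ω) = fun j => m + σ * y j := by
    ext j; simp only [hy]; field_simp; ring
  have havg : ∀ n, 1 ≤ n → runningAvg (fun j => Y j ω) n = m + σ * runningAvg y n := by
    intro n hn; rw [hY, runningAvg_affine m σ y hn]
  have hlt : ∀ w, m - γ₀ < m + σ * w ↔ -(γ₀ / σ) < w := by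
    intro w
    rw [← neg_div, div_lt_iff₀' hσ]
    constructor <;> intro h <;> linarith
  change (∃ v, IsLeast {v | ∃ n, 1 ≤ n ∧ v = runningAvg (fun j => Y j ω) n} v ∧ m - γ₀ < v) ↔ _
  constructor
  · rintro ⟨v, ⟨⟨n, hn, rfl⟩, hleast⟩, hv⟩
    refine ⟨n, hn, fun i hi => ?_, ?_⟩
    · have := hleast ⟨i, hi, rfl⟩
      rw [havg n hn, havg i hi] at this
      exact le_of_mul_le_mul_left (by linarith) hσ
    · rw [havg n hn] at hv
      exact (hlt _).1 hv
  · rintro ⟨n, hn, hmin, hv⟩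
    refine ⟨_, ⟨⟨n, hn, rfl⟩, ?_⟩, ?_⟩
    · rintro _ ⟨i, hi, rfl⟩
      rw [havg n hn, havg i hi]
      have := hmin i hi
      gcongr
    · rw [havg n hn]
      exact (hlt _).2 hv

end MinAbove

/-! ### The critical level and the limit of PCS -/

theorem one_le_boundaryC (x : ℝ) : 1 ≤ boundaryC x :=
  Real.one_le_exp (tsum_nonneg (boundaryC_term_nonneg x))

/-- The intermediate value theorem in x = (γ - γ₀)/σ: C exceeds c near 0 and is below it at γ/σ;
strict monotonicity gives uniqueness. -/
theorem existsUnique_boundaryC_eq {γ σ c : ℝ} (hγ : 0 < γ) (hσ : 0 < σ)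
    (hc : boundaryC (γ / σ) < c) :
    ∃! γ₀ : ℝ, γ₀ ∈ Set.Ioo 0 γ ∧ boundaryC ((γ - γ₀) / σ) = c := by
  obtain ⟨x₁, hx₁, hC⟩ := exists_lt_boundaryC c (div_pos hγ hσ)
  obtain ⟨x, hx, hxc⟩ := intermediate_value_Icc' hx₁.2.le
    (boundaryC_continuousOn.mono fun y hy => hx₁.1.trans_le hy.1) ⟨hc.le, hC.le⟩
  have hx0 : 0 < x := hx₁.1.trans_le hx.1
  have hxlt : x < γ / σ := hx.2.lt_of_ne fun h => by rw [h] at hxc; exact hc.ne hxc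
  refine ⟨γ - σ * x, ⟨⟨?_, ?_⟩, ?_⟩, ?_⟩
  · rw [lt_div_iff₀' hσ] at hxlt; linarith
  · linarith [mul_pos hσ hx0]
  · rw [sub_sub_cancel, mul_div_cancel_left₀ _ hσ.ne', hxc]
  · rintro γ₁ ⟨⟨h1, h2⟩, h3⟩
    have h4 := boundaryC_strictAntiOn.injOn (div_pos (sub_pos.2 h2) hσ) hx0 (h3.trans hxc.symm)
    rw [div_eq_iff hσ.ne'] at h4
    linarith

/-- In an infinite array, the selection event eventually occurs if the running averages of the
first row stay above `x - r`, and the rejection event eventually occurs if they do not. -/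
theorem ae_eventually_mem_events {x r c : ℝ} {B : ℕ → ℕ} (hx : 0 < x) (hxc : boundaryC x = c)
    (hB : ∀ k : ℕ, |(B k : ℝ) - c * ((k : ℝ) + 1)| < 1) :
    ∀ᵐ z ∂normalArrayLaw ℕ,
      (z 0 ∈ (⋂ n, stayPos (x - r) n) →
        ∀ᶠ k : ℕ in atTop, (fun i : Fin (k + 1) => z i) ∈ selectEvent r k (B k)) ∧
      (z 0 ∉ (⋂ n, stayPos (x - r) n) →
        ∀ᶠ k : ℕ in atTop, (fun i : Fin (k + 1) => z i) ∈ rejectEvent r k (B k)) := by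
  have h1 : ∀ᵐ z ∂normalArrayLaw ℕ, ∀ q : ℚ, 0 < q → Tendsto (fun k : ℕ =>
      (∑ i ∈ Finset.range k, (passageTime q (z (i + 1))).toReal) / k) atTop
        (𝓝 (boundaryC q)) := by
    rw [ae_all_iff]
    intro q
    by_cases hq : 0 < q
    · filter_upwards [ae_tendsto_avg_passageTime (x := q) (by exact_mod_cast hq)] with z hz _
      exact hz
    · exact Eventually.of_forall fun _ h => absurd h hq
  have h2 : ∀ᵐ z ∂normalArrayLaw ℕ, ∀ q : ℚ, 0 < q → ∀ i, ∃ n, IsFirstPassage q (z i) n := by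
    rw [ae_all_iff]
    intro q
    by_cases hq : 0 < q
    · have : ∀ᵐ z ∂normalArrayLaw ℕ, ∀ i, ∃ n, IsFirstPassage q (z i) n :=
        ae_all_iff.2 fun i => ae_normalArrayLaw_eval i
          (ae_exists_isFirstPassage (by exact_mod_cast hq))
      filter_upwards [this] with z hz _
      exact hz
    · exact Eventually.of_forall fun _ h => absurd h hq
  filter_upwards [h1, h2, ae_normalArrayLaw_eval 0 ae_tendsto_runningAvg,
    ae_normalArrayLaw_eval 0 ae_exists_runningAvg_neg,
    ae_normalArrayLaw_eval 0 (ae_runningAvg_ne (x - r))] with z hlim hpass hz ⟨m, hm, hm0⟩ hne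
  rw [mem_iInter_stayPos_iff]
  constructor
  · intro habove
    obtain ⟨n, hn, hmin, hmin'⟩ := exists_last_min hz hm hm0
    exact eventually_mem_selectEvent hx hxc hB hlim hpass hn hmin hmin' (habove n hn)
  · intro hbelow
    push Not at hbelow
    exact eventually_mem_rejectEvent hx hxc hB hlim hpass hne hbelow

/-- The `k`-th problem has the `k + 1` alternatives `Fin (k + 1)`, the best one being `0`; its
budget `B k` is `c (k + 1)` rounded to a neighbouring integer. -/
theorem theorem2
    {Ω : ℕ → Type*} [∀ k, MeasurableSpace (Ω k)]
    (P : ∀ k, Measure (Ω k)) [∀ k, IsProbabilityMeasure (P k)]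
    (X : ∀ k, Fin (k + 1) → ℕ → Ω k → ℝ)
    (μ : ∀ k, Fin (k + 1) → ℝ) (γ σ c : ℝ) (hγ : 0 < γ) (hσ : 0 < σ)
    (hslip : ∀ k, ∀ i : Fin (k + 1), i ≠ 0 → μ k 0 - μ k i = γ)
    (hlaw : ∀ k i j, HasLaw (X k i j) (gaussianReal (μ k i) (σ ^ 2).toNNReal) (P k))
    (hindep : ∀ k, iIndepFun (fun p : Fin (k + 1) × ℕ => X k p.1 p.2) (P k))
    (a : ∀ k, (Fin (k + 1) → ℝ) → Fin (k + 1)) (ha : ∀ k, IsArgmaxRule (a k))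
    (hc : boundaryC (γ / σ) < c)
    (B : ℕ → ℕ) (hB : ∀ k : ℕ, |(B k : ℝ) - c * ((k : ℝ) + 1)| < 1) :
    (∃! γ₀ : ℝ, γ₀ ∈ Set.Ioo 0 γ ∧ boundaryC ((γ - γ₀) / σ) = c) ∧
    ∀ γ₀ ∈ Set.Ioo 0 γ, boundaryC ((γ - γ₀) / σ) = c →
      Tendsto (fun k => greedyPCS (P k) (X k) (a k) (B k) 0) atTop
        (𝓝 (boundaryC (γ₀ / σ))⁻¹) ∧
      ∀ k, probMinAbove (P k) (X k 0) (μ k 0 - γ₀) = (boundaryC (γ₀ / σ))⁻¹ := by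
  refine ⟨existsUnique_boundaryC_eq hγ hσ hc, fun γ₀ hγ₀ hcrit => ?_⟩
  have hstd := fun k => hasLaw_standardized hσ (hlaw k) (hindep k)
  have hx : 0 < (γ - γ₀) / σ := div_pos (sub_pos.2 hγ₀.2) hσ
  have hxr : (γ - γ₀) / σ - γ / σ = -(γ₀ / σ) := by ring
  refine ⟨?_, fun k => ?_⟩
  -- The problems live on unrelated spaces, but only laws matter: all are carried to one infinite
  -- array, where almost sure limits make sense.
  · set Q := normalArrayLaw ℕ
    let A : Set (ℕ → ℕ → ℝ) := {z | z 0 ∈ ⋂ n, stayPos (-(γ₀ / σ)) n}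
    have hA₀ : MeasurableSet (⋂ n, stayPos (-(γ₀ / σ)) n) :=
      .iInter fun n => measurableSet_stayPos _ n
    have hA : MeasurableSet A := (measurable_pi_apply 0) hA₀
    have hQA : Q.real A = (boundaryC (γ₀ / σ))⁻¹ := by
      rw [← normalSeqLaw_real_iInter_stayPos (div_pos hγ₀.1 hσ)]
      exact (measurePreserving_eval_infinitePi (fun _ : ℕ => normalSeqLaw) 0).measureReal_preimage
        hA₀.nullMeasurableSet
    have hrestr : ∀ k, Measurable fun (z : ℕ → ℕ → ℝ) (i : Fin (k + 1)) => z i := fun k => by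
      fun_prop
    let G : ℕ → Set (ℕ → ℕ → ℝ) := fun k =>
      (fun z (i : Fin (k + 1)) => z i) ⁻¹' selectEvent (γ / σ) k (B k)
    let R : ℕ → Set (ℕ → ℕ → ℝ) := fun k =>
      (fun z (i : Fin (k + 1)) => z i) ⁻¹' rejectEvent (γ / σ) k (B k)
    have hG : ∀ k, MeasurableSet (G k) := fun k => hrestr k (measurableSet_selectEvent _ _ _)
    have hR : ∀ k, MeasurableSet (R k) := fun k => hrestr k (measurableSet_rejectEvent _ _ _)
    have hae := ae_eventually_mem_events (r := γ / σ) hx hcrit hB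
    rw [hxr] at hae
    have hlow : Tendsto (fun k => Q.real (G k ∩ A)) atTop (𝓝 (Q.real A)) :=
      tendsto_measureReal_inter_of_ae_eventually Q hA hG (hae.mono fun z hz => hz.1)
    -- The upper bound comes from rejection on the complement of `A`; both bounds meet at the
    -- probability of `A`.
    have hup : Tendsto (fun k => 1 - Q.real (R k ∩ Aᶜ)) atTop (𝓝 (1 - Q.real Aᶜ)) :=
      (tendsto_measureReal_inter_of_ae_eventually Q hA.compl hR
        (hae.mono fun z hz => hz.2)).const_sub 1
    rw [probReal_compl_eq_one_sub hA, sub_sub_cancel] at hup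
    rw [← hQA]
    -- Since c > C(γ/σ) ≥ 1, the budget eventually covers the initial observation of every
    -- alternative.
    have hbudget : ∀ᶠ k : ℕ in atTop, k + 1 ≤ B k := by
      filter_upwards [eventually_add_lt_budget hB ((one_le_boundaryC _).trans_lt hc) 1] with k hk
      rw [one_mul] at hk
      exact_mod_cast hk.le
    have hX : ∀ k (ω : Ω k), (fun i j => X k i j ω) =
        fun i j => μ k i + σ * ((X k i j ω - μ k i) / σ) := by
      intro k ω; ext i j; field_simp; ring
    have hmapQ : ∀ k {S : Set (Fin (k + 1) → ℕ → ℝ)}, MeasurableSet S →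
        (P k).real ((fun ω i j => (X k i j ω - μ k i) / σ) ⁻¹' S) =
          Q.real ((fun z (i : Fin (k + 1)) => z i) ⁻¹' S) := by
      intro k S hS
      rw [measureReal_preimage_of_hasLaw (hstd k) hS, ← normalArrayLaw_map_fin,
        map_measureReal_apply (hrestr k) hS]
    refine tendsto_of_tendsto_of_tendsto_of_le_of_le' hlow hup ?_ ?_
    · filter_upwards [hbudget] with k hk
      refine (measureReal_mono Set.inter_subset_left).trans ?_
      rw [← hmapQ k (measurableSet_selectEvent _ _ _)]
      refine measureReal_mono fun ω hω => ?_
      rw [Set.mem_ofPred_eq, hX]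
      exact greedySelection_eq_of_mem (ha k) hσ (hslip k) hk hω
    · filter_upwards [hbudget] with k hk
      have h1 : Q.real (R k ∩ Aᶜ) ≤ Q.real (R k) := measureReal_mono Set.inter_subset_left
      have hc' := (measurableSet_rejectEvent (γ / σ) k (B k)).compl
      have h2 : greedyPCS (P k) (X k) (a k) (B k) 0 ≤ Q.real (R k)ᶜ := by
        change _ ≤ Q.real ((fun z (i : Fin (k + 1)) => z i) ⁻¹' (rejectEvent (γ / σ) k (B k))ᶜ)
        rw [← hmapQ k hc']
        refine measureReal_mono fun ω hω hmem => ?_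
        rw [Set.mem_ofPred_eq, hX] at hω
        exact greedySelection_ne_of_mem (ha k) hσ (hslip k) hk hmem hω
      rw [probReal_compl_eq_one_sub (hR k)] at h2
      linarith
  · have heval := measurePreserving_eval_infinitePi (fun _ : Fin (k + 1) => normalSeqLaw) 0
    refine probMinAbove_eq hσ hγ₀.1 ⟨?_, ?_⟩
    · exact heval.measurable.comp_aemeasurable (hstd k).aemeasurable
    · have h := heval.map_eq
      rw [show (Measure.infinitePi fun _ : Fin (k + 1) => normalSeqLaw) = _ from (hstd k).map_eq.symm,
        AEMeasurable.map_map_of_aemeasurable heval.measurable.aemeasurable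
        (hstd k).aemeasurable] at h
      exact h
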